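/- **Operator Stokes theorem for the quantum electromagnetic field.** *Field.* Let $\mathbb{R}^4$ be Minkowski space-time with metric $g=\mathrm{diag}(1,-1,-1,-1)$, write $p\cdot q$ for the inner product of $g$, and let indices $\mu,\nu,\alpha,\beta\in\{0,1,2,3\}$ be summed when repeated. A *quantum electromagnetic field* consists of: a complex Hilbert space $\mathcal H$ with a strongly continuous unitary representation $U$ of the restricted Poincaré group (pairs $P=(a,L)$ acting by $Px=a+Lx$), satisfying the spectrum condition (the joint spectrum of the translations lies in the closed forward cone $\{p : p\cdot p\ge 0,\ p^0\ge 0\}$) and having, up to scalars, a unique invariant vector $\Omega$, $\|\Omega\|=1$; a dense subspace $\mathcal D\ni\Omega$ with $U(P)\mathcal D\subseteq\mathcal D$ for all $P$; and real-linear maps $f\mapsto F_{\mu\nu}(f)$ from the real Schwartz functions $f\in\mathcal S(\mathbb{R}^4)$ to linear maps $\mathcal D\to\mathcal D$ such that * $f\mapsto(\phi,F_{\mu\nu}(f)\psi)$ is continuous on $\mathcal S(\mathbb R^4)$ for all $\phi,\psi\in\mathcal D$; * $F_{\mu\nu}(T^{\mu\nu})$ is essentially self-adjoint on $\mathcal D$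 for all families $T^{\mu\nu}\in\mathcal S(\mathbb{R}^4)$ of real functions (this includes each single $F_{\mu\nu}(f)$ and the contractions $F_{\mu\nu}(f^\mu)$); * $U(P)F_{\mu\nu}(f)U(P)^*=L^{\alpha}{}_{\mu}L^{\beta}{}_{\nu}\,F_{\alpha\beta}(f\circ P^{-1})$ for $P=(a,L)$; * $\exp(iF_{\mu\nu}(f))$ and $\exp(iF_{\alpha\beta}(g))$ (exponentials of the closures) commute whenever $\mathrm{supp} f$ and $\mathrm{supp} g$ are spacelike separated; * $F_{\mu\nu}=-F_{\nu\mu}$, and $F_{\mu\nu}(\partial_\rho f)+F_{\nu\rho}(\partial_\mu f)+F_{\rho\mu}(\partial_\nu f)=0$ for all $f$ (first Maxwell equation). *Simplices.* Let $\Delta_n=\{t\in\mathbb{R}^n : t_i\ge 0,\ \sum_i t_i\le 1\}$. A *singular $n$-simplex* is a piecewise smooth map $\chi:\Delta_n\to\mathbb{R}^4$, where piecewise smooth means that $\chi$ is Lipschitz and that $\Delta_n$ is a union of finitely many convex sets on each of which $\chi$ is $C^\infty$. The boundary of a $2$-simplex $\sigma$ is the integral $1$-chain $\partial\sigma=\partial_0\sigma-\partial_1\sigma+\partial_2\sigma$,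 where $\partial_0\sigma(t)=\sigma(1-t,t)$, $\partial_1\sigma(t)=\sigma(0,t)$, $\partial_2\sigma(t)=\sigma(t,0)$. Put $\sigma^{\mu\nu}=\partial_{t_1}\sigma^\mu\,\partial_{t_2}\sigma^\nu-\partial_{t_2}\sigma^\mu\,\partial_{t_1}\sigma^\nu$. *Integrals.* For a $2$-simplex $\sigma$, a $1$-simplex $\gamma$, a real $f\in\mathcal S(\mathbb{R}^4)$ with $0\in\mathrm{supp} f$ and a *pole* $z\in\mathbb{R}^4$, put $$\sigma[f]^{\mu\nu}(x)=\int_{\Delta_2}f(x-\sigma(t))\,\sigma^{\mu\nu}(t)\,d^2t,$$ $$\gamma_f^{z,\mu\nu}(x)=\int_0^1\Big(\int_0^1(\gamma(s)-z)^\mu\,t\,f\big(x-z-t(\gamma(s)-z)\big)\,dt\Big)\dot\gamma^\nu(s)\,ds,$$ which are functions in $\mathcal S(\mathbb{R}^4)$. The surface integral of the field and the line integral of the potential form with pole $z$ are the operators $$F\langle\sigma,f\rangle=\tfrac12F_{\mu\nu}(\sigma[f]^{\mu\nu}),\qquad A^z\langle\gamma,f\rangle=F_{\mu\nu}(\gamma_f^{z,\mu\nu})$$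 on $\mathcal D$; extend $\gamma\mapsto A^z\langle\gamma,f\rangle$ additively to integral $1$-chains. **Proposition 3.10.** Let $z\in\mathbb{R}^4$, let $f\in\mathcal S(\mathbb{R}^4)$ be real with $0\in\mathrm{supp} f$, and let $\sigma$ be a singular piecewise smooth $2$-simplex. If $\gamma$ is a curve (a $1$-simplex) with $\gamma=\partial\sigma$ as $1$-chains (so that $\gamma$ is closed), then $$A^z\langle\gamma,f\rangle=F\langle\sigma,f\rangle\quad\text{on }\mathcal D.$$ The same holds for a $1$-chain: if $\ell=\partial\sigma$, then $A^z\langle\ell,f\rangle=F\langle\sigma,f\rangle$ on $\mathcal D$. -/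

import Mathlib

open MeasureTheory SchwartzMap Set
open scoped ContDiff LineDeriv BigOperators

noncomputable section

namespace QED

/-! ## Space-time, the Poincaré group -/

/-- The underlying vector space `ℝ⁴` of Minkowski space-time; points have the contravariant
coordinates `x 0, x 1, x 2, x 3`. -/
abbrev Spacetime : Type := EuclideanSpace ℝ (Fin 4)

/-- Real test functions on `ℝ⁴`. -/
abbrev TestFn : Type := 𝓢(Spacetime, ℝ)

/-- The Minkowski inner product, with signature `(+,-,-,-)`. -/
def minkowski (x y : Spacetime) : ℝ := x 0 * y 0 - x 1 * y 1 - x 2 * y 2 - x 3 * y 3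

/-- Two subsets are causally disjoint if their points are pairwise spacelike separated. -/
def CausallyDisjoint (X Y : Set Spacetime) : Prop :=
  ∀ x ∈ X, ∀ y ∈ Y, minkowski (x - y) (x - y) < 0

/-- The closed forward light cone. -/
def forwardCone : Set Spacetime := {p | 0 ≤ minkowski p p ∧ 0 ≤ p 0}

/-- The matrix of the metric tensor. -/
def metric : Matrix (Fin 4) (Fin 4) ℝ := Matrix.diagonal ![1, -1, -1, -1]

/-- The restricted Lorentz group, as a set of matrices `L μ ν = L^μ_ν`. -/
def restrictedLorentz : Set (Matrix (Fin 4) (Fin 4) ℝ) :=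
  {L | L.transpose * metric * L = metric ∧ 0 < L.det ∧ 1 ≤ L 0 0}

/-- The underlying topological space of the Poincaré group: pairs `(a, L)` of a translation and a
restricted Lorentz matrix. -/
abbrev Poincare : Type := {P : Spacetime × Matrix (Fin 4) (Fin 4) ℝ // P.2 ∈ restrictedLorentz}

/-- The action `P x = a + L x`. -/
def Poincare.act (P : Poincare) (x : Spacetime) : Spacetime :=
  P.1.1 + WithLp.toLp 2 (P.1.2.mulVec x.ofLp)

/-- The translation by `a`, as an element of the Poincaré group. -/
def Poincare.translation (a : Spacetime) : Poincare :=
  ⟨(a, 1), by simp [restrictedLorentz]⟩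

/-! ## Unbounded operators on a common invariant domain -/

section Operators

variable {ℋ : Type*} [NormedAddCommGroup ℋ] [InnerProductSpace ℂ ℋ]

/-- A linear map of the domain `D` into itself, as an unbounded operator on the Hilbert space. -/
def toUnbounded {D : Submodule ℂ ℋ} (T : D →ₗ[ℂ] D) : ℋ →ₗ.[ℂ] ℋ :=
  ⟨D, D.subtype ∘ₗ T⟩

/-- Essential self-adjointness on `D`: the closure of the operator is self-adjoint. -/
def EssentiallySelfAdjoint [CompleteSpace ℋ] {D : Submodule ℂ ℋ} (T : D →ₗ[ℂ] D) : Prop :=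
  IsSelfAdjoint (toUnbounded T).closure

/-- `V` is the strongly continuous one-parameter unitary group `t ↦ exp (i t A)`: the set of
vectors at which `V` is differentiable is the domain of `A`, and there the derivative is `i A`.
(By Stone's theorem there is exactly one such `V` when `A` is self-adjoint.) -/
structure IsExpGroup (A : ℋ →ₗ.[ℂ] ℋ) (V : ℝ → ℋ ≃ₗᵢ[ℂ] ℋ) : Prop where
  add : ∀ s t ψ, V (s + t) ψ = V s (V t ψ)
  cont : ∀ ψ, Continuous fun t => V t ψ
  generator : ∀ ψ φ : ℋ,
    HasDerivAt (fun t : ℝ => V t ψ) (Complex.I • φ) 0 ↔ ∃ h : ψ ∈ A.domain, A ⟨ψ, h⟩ = φ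

end Operators

/-! ## The quantum electromagnetic field -/

/-- The quantum electromagnetic field (not necessarily free). The second Maxwell equation
`∂^μ F_{μν} = J_ν` only defines the current `J`, hence imposes nothing. -/
structure QuantumEMField (ℋ : Type*) [NormedAddCommGroup ℋ] [InnerProductSpace ℂ ℋ]
    [CompleteSpace ℋ] where
  /-- the unitary representation of the Poincaré group -/
  U : Poincare → ℋ ≃ₗᵢ[ℂ] ℋ
  /-- the group law is `(a, L) (a', L') = (a + L a', L L')` -/
  U_mul : ∀ P Q R : Poincare, R.1.1 = P.act Q.1.1 → R.1.2 = P.1.2 * Q.1.2 →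
    ∀ ψ, U R ψ = U P (U Q ψ)
  U_continuous : ∀ ψ, Continuous fun P => U P ψ
  /-- spectrum condition: the joint spectral measure of the translations
  `U(a) = ∫ exp (i a·p) dE(p)` is supported in the closed forward cone -/
  spectrum_condition : ∀ (g : 𝓢(Spacetime, ℂ)),
    (∀ p ∈ forwardCone, ∫ a, g a * Complex.exp (Complex.I * (minkowski a p : ℝ)) = 0) →
    ∀ ψ : ℋ, ∫ a, g a • U (Poincare.translation a) ψ = 0
  /-- the vacuum vector -/
  Ω : ℋ
  norm_Ω : ‖Ω‖ = 1
  Ω_invariant : ∀ P, U P Ω = Ω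
  Ω_unique : ∀ ψ, (∀ P, U P ψ = ψ) → ∃ c : ℂ, ψ = c • Ω
  /-- the common invariant domain -/
  D : Submodule ℂ ℋ
  D_dense : Dense (D : Set ℋ)
  Ω_mem : Ω ∈ D
  U_mem : ∀ P, ∀ ψ ∈ D, U P ψ ∈ D
  /-- the components `F_{μν}(f)` of the field, as linear maps of `D` into itself -/
  F : Fin 4 → Fin 4 → TestFn →ₗ[ℝ] (D →ₗ[ℂ] D)
  /-- `F_{μν}` is an operator-valued tempered distribution -/
  F_continuous : ∀ μ ν (φ ψ : D), Continuous fun f : TestFn => inner ℂ (φ : ℋ) (F μ ν f ψ : ℋ)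
  /-- contractions of the field with real tensor-valued test functions are essentially
  self-adjoint; this includes the individual operators `F_{μν}(f)` and the contractions with
  1-tensors, for which the tensor has one nonzero entry, respectively one nonzero row -/
  F_essentiallySelfAdjoint : ∀ T : Fin 4 → Fin 4 → TestFn,
    EssentiallySelfAdjoint (∑ μ, ∑ ν, F μ ν (T μ ν))
  /-- covariance: `U(P) F_{μν}(f) U(P)* = L^α_μ L^β_ν F_{αβ}(f')` with `f' = f ∘ P⁻¹` -/
  F_covariant : ∀ (P : Poincare) (f f' : TestFn), (∀ x, f' (P.act x) = f x) →
    ∀ (μ ν : Fin 4) (ψ : D), U P (F μ ν f ψ : ℋ) =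
      ∑ α, ∑ β, ((P.1.2 α μ * P.1.2 β ν : ℝ) : ℂ) • (F α β f' ⟨U P ψ, U_mem P ψ ψ.2⟩ : ℋ)
  /-- strong causality: `exp (i F_{μν}(f))` and `exp (i F_{αβ}(g))` commute -/
  F_causal : ∀ (μ ν α β : Fin 4) (f g : TestFn), CausallyDisjoint (tsupport f) (tsupport g) →
    ∀ V W : ℝ → ℋ ≃ₗᵢ[ℂ] ℋ, IsExpGroup (toUnbounded (F μ ν f)).closure V →
      IsExpGroup (toUnbounded (F α β g)).closure W → ∀ ψ, V 1 (W 1 ψ) = W 1 (V 1 ψ)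
  F_antisymm : ∀ μ ν f, F μ ν f = - F ν μ f
  /-- the first Maxwell equation, in the sense of distributions -/
  F_maxwell : ∀ (σ μ ν : Fin 4) (f : TestFn),
    F μ ν (∂_{EuclideanSpace.single σ (1 : ℝ)} f) + F ν σ (∂_{EuclideanSpace.single μ (1 : ℝ)} f)
      + F σ μ (∂_{EuclideanSpace.single ν (1 : ℝ)} f) = 0

/-! ## Singular piecewise smooth simplices -/

/-- The standard simplex `{t ∈ ℝⁿ | t_i ≥ 0, ∑ t_i ≤ 1}`. -/
def Delta (n : ℕ) : Set (Fin n → ℝ) := {t | (∀ i, 0 ≤ t i) ∧ ∑ i, t i ≤ 1}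

open Classical in
/-- Extension by `0` of a map defined on the standard simplex (used only in order to differentiate
and integrate it). -/
def extend {n : ℕ} (χ : Delta n → Spacetime) (t : Fin n → ℝ) : Spacetime :=
  if h : t ∈ Delta n then χ ⟨t, h⟩ else 0

/-- A map `Δ_n → ℝ⁴` is piecewise smooth if `Δ_n` can be cut into finitely many convex pieces on
each of which the map is smooth, and the map is Lipschitz, i.e. it is continuous across the pieces
and its first derivatives (which may be discontinuous) are bounded. The pieces need be neither
open nor closed, so that cones over piecewise smooth simplices are piecewise smooth: they are
smooth on the cones over the pieces without the apex, and on the apex. -/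
def PiecewiseSmooth {n : ℕ} (χ : Delta n → Spacetime) : Prop :=
  (∃ K, LipschitzWith K χ) ∧
  ∃ 𝒞 : Set (Set (Fin n → ℝ)), 𝒞.Finite ∧ ⋃₀ 𝒞 = Delta n ∧
    ∀ C ∈ 𝒞, Convex ℝ C ∧ ContDiffOn ℝ ∞ (extend χ) C

/-- Singular piecewise smooth `n`-simplices in `ℝ⁴`. -/
structure Simplex (n : ℕ) where
  toFun : Delta n → Spacetime
  piecewiseSmooth : PiecewiseSmooth toFun

/-- The `i`-th face inclusion of `ℝⁿ` into `ℝⁿ⁺¹`: `(1 - ∑ t_j, t_1, …, t_n)` for `i = 0`, and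
`(t_1, …, t_{i-1}, 0, t_i, …, t_n)` for `i > 0`. -/
def faceIncl {n : ℕ} (i : Fin (n + 2)) (t : Fin n → ℝ) : Fin (n + 1) → ℝ :=
  Fin.cases (motive := fun _ => Fin (n + 1) → ℝ) (Fin.cons (1 - ∑ j, t j) t)
    (fun j => Fin.insertNth (α := fun _ => ℝ) j 0 t) i

theorem faceIncl_apply_affine {n : ℕ} (i : Fin (n + 2)) (k : Fin (n + 1)) :
    (∃ c : ℝ, ∃ l : (Fin n → ℝ) →L[ℝ] ℝ, ∀ t, faceIncl i t k = c + l t) := by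
  refine Fin.cases ?_ (fun j => ?_) i
  · refine Fin.cases ?_ (fun k => ?_) k
    · refine ⟨1, -∑ j, ContinuousLinearMap.proj (R := ℝ) (φ := fun _ : Fin n => ℝ) j, fun t => ?_⟩
      simp [faceIncl, sub_eq_add_neg]
    · refine ⟨0, ContinuousLinearMap.proj (R := ℝ) (φ := fun _ : Fin n => ℝ) k, fun t => ?_⟩
      simp [faceIncl]
  · refine Fin.succAboveCases j ?_ (fun k => ?_) k
    · exact ⟨0, 0, fun t => by simp [faceIncl]⟩
    · refine ⟨0, ContinuousLinearMap.proj (R := ℝ) (φ := fun _ : Fin n => ℝ) k, fun t => ?_⟩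
      simp [faceIncl]

theorem exists_faceIncl_eq {n : ℕ} (i : Fin (n + 2)) :
    ∃ c : Fin (n + 1) → ℝ, ∃ l : (Fin n → ℝ) →L[ℝ] (Fin (n + 1) → ℝ),
      ∀ t, faceIncl i t = c + l t := by
  choose c l h using faceIncl_apply_affine i
  exact ⟨c, ContinuousLinearMap.pi l, fun t => funext fun k => by simp [h]⟩

theorem faceIncl_mem {n : ℕ} (i : Fin (n + 2)) {t : Fin n → ℝ} (ht : t ∈ Delta n) :
    faceIncl i t ∈ Delta (n + 1) := by
  obtain ⟨h0, h1⟩ := ht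
  refine Fin.cases ?_ (fun j => ?_) i
  · refine ⟨fun k => ?_, ?_⟩
    · refine Fin.cases ?_ (fun k => ?_) k
      · simpa [faceIncl] using h1
      · simpa [faceIncl] using h0 k
    · simp [faceIncl, Fin.sum_univ_succ]
  · refine ⟨fun k => ?_, ?_⟩
    · refine Fin.succAboveCases j ?_ (fun k => ?_) k
      · simp [faceIncl]
      · simpa [faceIncl] using h0 k
    · rw [Fin.sum_univ_succAbove _ j]
      simpa [faceIncl] using h1

/-- The face maps `∂_i χ`. -/
def Simplex.face {n : ℕ} (χ : Simplex (n + 1)) (i : Fin (n + 2)) : Simplex n where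
  toFun t := χ.toFun ⟨faceIncl i t, faceIncl_mem i t.2⟩
  piecewiseSmooth := by
    obtain ⟨⟨K, hK⟩, 𝒞, hfin, hcov, hC⟩ := χ.piecewiseSmooth
    obtain ⟨c, l, hl⟩ := exists_faceIncl_eq i
    refine ⟨⟨K * ‖l‖₊, ?_⟩, (fun C => faceIncl i ⁻¹' C ∩ Delta n) '' 𝒞, hfin.image _, ?_, ?_⟩
    · refine hK.comp (LipschitzWith.of_dist_le_mul fun s t => ?_)
      rw [Subtype.dist_eq, Subtype.dist_eq]
      simp only [hl, dist_add_left]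
      exact l.lipschitz.dist_le_mul _ _
    · ext t
      simp only [mem_sUnion, mem_image, exists_exists_and_eq_and, mem_inter_iff, mem_preimage]
      refine ⟨fun ⟨_, _, _, h⟩ => h, fun h => ?_⟩
      have := faceIncl_mem i h
      rw [← hcov] at this
      obtain ⟨C, hC1, hC2⟩ := this
      exact ⟨C, hC1, hC2, h⟩
    · rintro _ ⟨C, hCm, rfl⟩
      obtain ⟨hconv, hsm⟩ := hC C hCm
      refine ⟨?_, ?_⟩
      · rintro x ⟨hx, hx0, hx1⟩ y ⟨hy, hy0, hy1⟩ a b ha hb hab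
        refine ⟨?_, fun j => ?_, ?_⟩
        · have : faceIncl i (a • x + b • y) = a • faceIncl i x + b • faceIncl i y := by
            simp only [hl, map_add, map_smul, smul_add]
            nth_rewrite 1 [← one_smul ℝ c]
            rw [← hab, add_smul]
            abel
          rw [mem_preimage, this]
          exact hconv hx hy ha hb hab
        · have := mul_nonneg ha (hx0 j)
          have := mul_nonneg hb (hy0 j)
          simp only [Pi.add_apply, Pi.smul_apply, smul_eq_mul]
          linarith
        · simp only [Pi.add_apply, Pi.smul_apply, smul_eq_mul, Finset.sum_add_distrib,
            ← Finset.mul_sum]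
          nlinarith
      · have hf : ContDiff ℝ ∞ (faceIncl (n := n) i) := by
          have : faceIncl (n := n) i = fun t => c + l t := funext hl
          rw [this]
          exact contDiff_const.add l.contDiff
        refine (hsm.comp hf.contDiffOn fun t ht => ht.1).congr fun t ht => ?_
        simp only [extend, Function.comp]
        rw [dif_pos ht.2, dif_pos (faceIncl_mem i ht.2)]

/-- Singular chains: finite formal integer combinations of simplices. -/
abbrev Chain (n : ℕ) : Type := Simplex n →₀ ℤ

/-- The boundary `∂χ = ∑ (-1)^i ∂_i χ` of a simplex. -/
def Simplex.boundary {n : ℕ} (χ : Simplex (n + 1)) : Chain n :=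
  ∑ i : Fin (n + 2), Finsupp.single (χ.face i) ((-1) ^ (i : ℕ))

/-- The extension by `0` of a simplex to `ℝⁿ`. -/
def Simplex.ext {n : ℕ} (χ : Simplex n) : (Fin n → ℝ) → Spacetime := extend χ.toFun

/-- The partial derivative `∂χ / ∂t_j` (at interior points of `Δ_n`, hence almost everywhere). -/
def Simplex.partialDeriv {n : ℕ} (χ : Simplex n) (j : Fin n) (t : Fin n → ℝ) : Spacetime :=
  fderiv ℝ χ.ext t (Pi.single j 1)

/-- The surface element `σ^{μν} = ∂_1σ^μ ∂_2σ^ν - ∂_2σ^μ ∂_1σ^ν`. -/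
def Simplex.areaElement (σ : Simplex 2) (μ ν : Fin 4) (t : Fin 2 → ℝ) : ℝ :=
  σ.partialDeriv 0 t μ * σ.partialDeriv 1 t ν - σ.partialDeriv 1 t μ * σ.partialDeriv 0 t ν

/-- A 1-simplex as a curve with parameter in `[0,1]`, under the identification `Δ_1 = [0,1]`. -/
def Simplex.path (γ : Simplex 1) (s : ℝ) : Spacetime := γ.ext fun _ => s

/-! ## Smearing along a family of translations -/

section Smear

variable {T : Type*} [MeasurableSpace T] {m : Measure T} {p : T → Spacetime} {w : T → ℝ}

theorem smear_integrable {V : Type} [NormedAddCommGroup V] [NormedSpace ℝ V]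
    (hp : AEStronglyMeasurable p m) (hw : Integrable w m) (f : 𝓢(Spacetime, V))
    (x : Spacetime) : Integrable (fun t => w t • f (x - p t)) m := by
  obtain ⟨C, hC⟩ := f.decay 0 0
  refine hw.smul_bdd C ?_ (Filter.Eventually.of_forall fun t => ?_)
  · exact f.continuous.comp_aestronglyMeasurable (aestronglyMeasurable_const.sub hp)
  · simpa using hC.2 (x - p t)

theorem smear_hasFDerivAt {V : Type} [NormedAddCommGroup V] [NormedSpace ℝ V]
    (hp : AEStronglyMeasurable p m) (hw : Integrable w m) (f : 𝓢(Spacetime, V))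
    (x : Spacetime) :
    HasFDerivAt (fun x => ∫ t, w t • f (x - p t) ∂m)
      (∫ t, w t • fderivCLM ℝ Spacetime V f (x - p t) ∂m) x := by
  obtain ⟨C, hC⟩ := (fderivCLM ℝ Spacetime V f).decay 0 0
  refine hasFDerivAt_integral_of_dominated_of_fderiv_le (s := univ) (bound := fun t => ‖w t‖ * C)
    (F' := fun x t => w t • fderivCLM ℝ Spacetime V f (x - p t)) Filter.univ_mem
    (Filter.Eventually.of_forall fun x => (smear_integrable hp hw f x).aestronglyMeasurable)
    (smear_integrable hp hw f x) (smear_integrable hp hw _ x).aestronglyMeasurable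
    (Filter.Eventually.of_forall fun t x _ => ?_) (hw.norm.mul_const C)
    (Filter.Eventually.of_forall fun t x _ => ?_)
  · rw [norm_smul]
    exact mul_le_mul_of_nonneg_left (by simpa using hC.2 (x - p t)) (norm_nonneg _)
  · have h1 : HasFDerivAt f (fderivCLM ℝ Spacetime V f (x - p t)) (x - p t) := by
      simpa using (f.differentiable (x - p t)).hasFDerivAt
    have h2 := h1.comp x ((hasFDerivAt_id x).sub_const (p t))
    simpa [Function.comp_def, Pi.smul_def] using h2.const_smul (w t)

theorem smear_contDiff_nat (hp : AEStronglyMeasurable p m) (hw : Integrable w m) (n : ℕ) :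
    ∀ {V : Type} [NormedAddCommGroup V] [NormedSpace ℝ V] (f : 𝓢(Spacetime, V)),
      ContDiff ℝ n (fun x => ∫ t, w t • f (x - p t) ∂m) := by
  induction n with
  | zero =>
    intro V _ _ f
    refine contDiff_zero.2 (continuous_iff_continuousAt.2 fun x => ?_)
    exact (smear_hasFDerivAt hp hw f x).continuousAt
  | succ n ih =>
    intro V _ _ f
    refine contDiff_succ_iff_hasFDerivAt.2 ⟨_, ih (fderivCLM ℝ Spacetime V f), fun x => ?_⟩
    exact smear_hasFDerivAt hp hw f x

theorem smear_decay (hp : AEStronglyMeasurable p m) (hw : Integrable w m) {R : ℝ}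
    (hR : ∀ᵐ t ∂m, ‖p t‖ ≤ R) (k n : ℕ) :
    ∀ {V : Type} [NormedAddCommGroup V] [NormedSpace ℝ V] (f : 𝓢(Spacetime, V)),
      ∃ C, ∀ x, ‖x‖ ^ k * ‖iteratedFDeriv ℝ n (fun x => ∫ t, w t • f (x - p t) ∂m) x‖ ≤ C := by
  induction n with
  | zero =>
    intro V _ _ f
    obtain ⟨C0, hC0⟩ := f.decay 0 0
    obtain ⟨Ck, hCk⟩ := f.decay k 0
    set S := max R 0
    refine ⟨∫ t, ‖w t‖ * (2 ^ k * (Ck + S ^ k * C0)) ∂m, fun x => ?_⟩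
    rw [norm_iteratedFDeriv_zero]
    calc ‖x‖ ^ k * ‖∫ t, w t • f (x - p t) ∂m‖ = ‖∫ t, ‖x‖ ^ k • (w t • f (x - p t)) ∂m‖ := by
          rw [integral_smul, norm_smul]; simp
      _ ≤ _ := by
        refine norm_integral_le_of_norm_le (hw.norm.mul_const _) ?_
        filter_upwards [hR] with t ht
        have h0 := hC0.2 (x - p t)
        have hk := hCk.2 (x - p t)
        simp only [pow_zero, one_mul, norm_iteratedFDeriv_zero] at h0 hk
        have hS : ‖p t‖ ≤ S := ht.trans (le_max_left _ _)
        have hS0 : (0 : ℝ) ≤ S := le_max_right _ _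
        have hx : ‖x‖ ≤ ‖x - p t‖ + S := by
          have := norm_add_le (x - p t) (p t)
          rw [sub_add_cancel] at this
          linarith
        have hpow : ‖x‖ ^ k ≤ 2 ^ k * (‖x - p t‖ ^ k + S ^ k) := by
          refine (pow_le_pow_left₀ (norm_nonneg _) hx k).trans ?_
          refine (add_pow_le (norm_nonneg _) hS0 k).trans ?_
          gcongr
          · norm_num
          · omega
        rw [norm_smul, norm_smul, norm_pow, norm_norm]
        calc ‖x‖ ^ k * (‖w t‖ * ‖f (x - p t)‖)
            = ‖w t‖ * (‖x‖ ^ k * ‖f (x - p t)‖) := by ring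
          _ ≤ ‖w t‖ * ((2 ^ k * (‖x - p t‖ ^ k + S ^ k)) * ‖f (x - p t)‖) := by gcongr
          _ = ‖w t‖ * (2 ^ k * (‖x - p t‖ ^ k * ‖f (x - p t)‖ + S ^ k * ‖f (x - p t)‖)) := by
            ring
          _ ≤ ‖w t‖ * (2 ^ k * (Ck + S ^ k * C0)) := by gcongr
  | succ n ih =>
    intro V _ _ f
    obtain ⟨C, hC⟩ := ih (fderivCLM ℝ Spacetime V f)
    refine ⟨C, fun x => ?_⟩
    rw [← norm_iteratedFDeriv_fderiv]
    have : fderiv ℝ (fun x => ∫ t, w t • f (x - p t) ∂m) =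
        fun x => ∫ t, w t • fderivCLM ℝ Spacetime V f (x - p t) ∂m :=
      funext fun x => (smear_hasFDerivAt hp hw f x).fderiv
    rw [this]
    exact hC x

/-- A function which is a superposition of boundedly many translates of a test function is a test
function. -/
def mkSmear (hp : AEStronglyMeasurable p m) (hw : Integrable w m)
    (hR : ∃ R : ℝ, ∀ᵐ t ∂m, ‖p t‖ ≤ R) (f : TestFn) (g : Spacetime → ℝ)
    (hg : ∀ x, g x = ∫ t, w t • f (x - p t) ∂m) : TestFn where
  toFun := g
  smooth' := by
    rw [show g = _ from funext hg]
    exact contDiff_infty.2 fun n => smear_contDiff_nat hp hw n f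
  decay' k n := by
    rw [show g = _ from funext hg]
    obtain ⟨R, hR⟩ := hR
    exact smear_decay hp hw hR k n f

end Smear

/-! ## Regularity of piecewise smooth simplices -/

theorem isCompact_Delta (n : ℕ) : IsCompact (Delta n) := by
  refine (isCompact_univ_pi fun _ : Fin n => isCompact_Icc (a := (0 : ℝ)) (b := 1)).of_isClosed_subset
    ?_ ?_
  · have h1 : IsClosed {t : Fin n → ℝ | ∀ i, 0 ≤ t i} := by
      rw [show {t : Fin n → ℝ | ∀ i, 0 ≤ t i} = ⋂ i, {t | 0 ≤ t i} by ext; simp]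
      exact isClosed_iInter fun i => isClosed_le continuous_const (continuous_apply i)
    exact h1.inter (isClosed_le
      (continuous_finsetSum _ fun i _ => continuous_apply i) continuous_const)
  · rintro t ⟨h0, h1⟩ i -
    exact ⟨h0 i, (Finset.single_le_sum (fun j _ => h0 j) (Finset.mem_univ i)).trans h1⟩

theorem convex_Delta (n : ℕ) : Convex ℝ (Delta n) := by
  rintro x ⟨hx0, hx1⟩ y ⟨hy0, hy1⟩ a b ha hb hab
  refine ⟨fun j => ?_, ?_⟩
  · have := mul_nonneg ha (hx0 j)
    have := mul_nonneg hb (hy0 j)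
    simp only [Pi.add_apply, Pi.smul_apply, smul_eq_mul]
    linarith
  · simp only [Pi.add_apply, Pi.smul_apply, smul_eq_mul, Finset.sum_add_distrib, ← Finset.mul_sum]
    nlinarith

theorem Simplex.exists_lipschitzOnWith {n : ℕ} (χ : Simplex n) :
    ∃ K, LipschitzOnWith K χ.ext (Delta n) := by
  obtain ⟨K, hK⟩ := χ.piecewiseSmooth.1
  refine ⟨K, LipschitzOnWith.of_dist_le_mul fun s hs t ht => ?_⟩
  have := hK.dist_le_mul ⟨s, hs⟩ ⟨t, ht⟩
  simp only [Simplex.ext, extend]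
  rw [dif_pos hs, dif_pos ht]
  exact this

theorem Simplex.exists_bound {n : ℕ} (χ : Simplex n) : ∃ R : ℝ, ∀ t ∈ Delta n, ‖χ.ext t‖ ≤ R := by
  obtain ⟨K, hK⟩ := χ.exists_lipschitzOnWith
  exact (isCompact_Delta n).exists_bound_of_continuousOn hK.continuousOn

theorem Simplex.measurable_areaElement (σ : Simplex 2) (μ ν : Fin 4) :
    Measurable (σ.areaElement μ ν) := by
  have h : ∀ (j : Fin 2) (α : Fin 4), Measurable fun t => σ.partialDeriv j t α := fun j α => by
    have h1 : Measurable (σ.partialDeriv j) := measurable_fderiv_apply_const ℝ σ.ext _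
    fun_prop
  exact ((h 0 μ).mul (h 1 ν)).sub ((h 1 μ).mul (h 0 ν))

theorem Simplex.integrable_areaElement (σ : Simplex 2) (μ ν : Fin 4) :
    Integrable (σ.areaElement μ ν) (volume.restrict (Delta 2)) := by
  obtain ⟨K, hK⟩ := σ.exists_lipschitzOnWith
  have hfin : volume (Delta 2) ≠ ⊤ := (isCompact_Delta 2).measure_lt_top.ne
  have : IsFiniteMeasure (volume.restrict (Delta 2)) := ⟨by simpa using hfin.lt_top⟩
  refine Integrable.of_bound (σ.measurable_areaElement μ ν).aestronglyMeasurable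
    (K * K + K * K) ?_
  have hint : ∀ᵐ t ∂(volume.restrict (Delta 2)), t ∈ interior (Delta 2) := by
    have h0 : volume (frontier (Delta 2)) = 0 := (convex_Delta 2).addHaar_frontier _
    have h1 : ∀ᵐ t ∂(volume : Measure (Fin 2 → ℝ)), t ∉ frontier (Delta 2) :=
      measure_eq_zero_iff_ae_notMem.1 h0
    filter_upwards [ae_restrict_of_ae h1, ae_restrict_mem (isCompact_Delta 2).measurableSet]
      with t ht ht'
    by_contra h
    exact ht ⟨subset_closure ht', h⟩
  filter_upwards [hint] with t ht
  have hb : ∀ (j : Fin 2) (α : Fin 4), ‖σ.partialDeriv j t α‖ ≤ K := fun j α => by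
    refine (PiLp.norm_apply_le _ α).trans (((fderiv ℝ σ.ext t).le_opNorm _).trans ?_)
    have h1 := norm_fderiv_le_of_lipschitzOn ℝ (mem_interior_iff_mem_nhds.1 ht) hK
    have h2 : ‖(Pi.single j 1 : Fin 2 → ℝ)‖ = 1 := by simp [Pi.norm_single]
    rw [h2, mul_one]
    exact h1
  refine (norm_sub_le _ _).trans ?_
  rw [norm_mul, norm_mul]
  gcongr <;> exact hb _ _

theorem Simplex.path_lipschitzOnWith (γ : Simplex 1) :
    ∃ K, LipschitzOnWith K γ.path (Icc 0 1) := by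
  obtain ⟨K, hK⟩ := γ.exists_lipschitzOnWith
  refine ⟨K, LipschitzOnWith.of_dist_le_mul fun s hs t ht => ?_⟩
  have hm : ∀ s ∈ Icc (0 : ℝ) 1, (fun _ : Fin 1 => s) ∈ Delta 1 := fun s hs =>
    ⟨fun _ => hs.1, by simpa using hs.2⟩
  refine (hK.dist_le_mul _ (hm s hs) _ (hm t ht)).trans (le_of_eq ?_)
  rw [dist_pi_const]

/-- The measure `ds dt` on the unit square. -/
abbrev squareMeasure : Measure (ℝ × ℝ) :=
  (volume.restrict (Ioc (0 : ℝ) 1)).prod (volume.restrict (Ioc (0 : ℝ) 1))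

theorem ae_squareMeasure : ∀ᵐ q ∂squareMeasure, q.1 ∈ Ioo (0 : ℝ) 1 ∧ q.2 ∈ Icc (0 : ℝ) 1 := by
  rw [squareMeasure, Measure.prod_restrict, ← Measure.volume_eq_prod]
  have h : ∀ᵐ q ∂(volume : Measure (ℝ × ℝ)), q.1 ≠ 1 := by
    have : ∀ᵐ x ∂(volume : Measure ℝ), x ≠ 1 := by
      simp [ae_iff]
    exact Measure.quasiMeasurePreserving_fst.ae this
  filter_upwards [ae_restrict_of_ae h, ae_restrict_mem (measurableSet_Ioc.prod measurableSet_Ioc)]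
    with q hq1 hq2
  exact ⟨⟨hq2.1.1, lt_of_le_of_ne hq2.1.2 hq1⟩, hq2.2.1.le, hq2.2.2⟩

/-- The point `z + t (γ(s) - z)` of the cone over `γ` with apex `z`. -/
def Simplex.conePoint (γ : Simplex 1) (z : Spacetime) (q : ℝ × ℝ) : Spacetime :=
  z + q.2 • (γ.path q.1 - z)

theorem Simplex.aestronglyMeasurable_path (γ : Simplex 1) :
    AEStronglyMeasurable (fun q : ℝ × ℝ => γ.path q.1) squareMeasure := by
  obtain ⟨K, hK⟩ := γ.path_lipschitzOnWith
  have h : AEStronglyMeasurable γ.path (volume.restrict (Ioc (0 : ℝ) 1)) :=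
    (hK.continuousOn.mono Ioc_subset_Icc_self).aestronglyMeasurable measurableSet_Ioc
  exact h.comp_fst

theorem Simplex.aestronglyMeasurable_conePoint (γ : Simplex 1) (z : Spacetime) :
    AEStronglyMeasurable (γ.conePoint z) squareMeasure :=
  aestronglyMeasurable_const.add
    (continuous_snd.aestronglyMeasurable.smul
      (γ.aestronglyMeasurable_path.sub aestronglyMeasurable_const))

theorem Simplex.exists_path_bound (γ : Simplex 1) (z : Spacetime) :
    ∃ R : ℝ, ∀ s ∈ Icc (0 : ℝ) 1, ‖γ.path s - z‖ ≤ R := by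
  obtain ⟨K, hK⟩ := γ.path_lipschitzOnWith
  exact isCompact_Icc.exists_bound_of_continuousOn (hK.continuousOn.sub continuousOn_const)

theorem Simplex.conePoint_bound (γ : Simplex 1) (z : Spacetime) :
    ∃ R : ℝ, ∀ᵐ q ∂squareMeasure, ‖γ.conePoint z q‖ ≤ R := by
  obtain ⟨R, hR⟩ := γ.exists_path_bound z
  refine ⟨‖z‖ + R, ?_⟩
  filter_upwards [ae_squareMeasure] with q ⟨hq1, hq2⟩
  refine (norm_add_le _ _).trans ?_
  rw [norm_smul, Real.norm_of_nonneg hq2.1]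
  have h := hR q.1 (Ioo_subset_Icc_self hq1)
  nlinarith [norm_nonneg (γ.path q.1 - z), hq2.2, hq2.1]

/-- The weight `(γ(s) - z)^μ t (dγ/ds)^ν`. -/
def Simplex.coneWeight (γ : Simplex 1) (z : Spacetime) (μ ν : Fin 4) (q : ℝ × ℝ) : ℝ :=
  (γ.path q.1 - z) μ * q.2 * deriv γ.path q.1 ν

theorem Simplex.integrable_coneWeight (γ : Simplex 1) (z : Spacetime) (μ ν : Fin 4) :
    Integrable (γ.coneWeight z μ ν) squareMeasure := by
  obtain ⟨R, hR⟩ := γ.exists_path_bound z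
  obtain ⟨K, hK⟩ := γ.path_lipschitzOnWith
  refine Integrable.of_bound (C := R * K) ?_ ?_
  · have h1 : AEStronglyMeasurable (fun q : ℝ × ℝ => (γ.path q.1 - z) μ) squareMeasure :=
      (EuclideanSpace.proj (𝕜 := ℝ) μ).continuous.comp_aestronglyMeasurable
        (γ.aestronglyMeasurable_path.sub aestronglyMeasurable_const)
    have h2 : Measurable fun q : ℝ × ℝ => deriv γ.path q.1 ν := by
      have : Measurable fun q : ℝ × ℝ => deriv γ.path q.1 := (measurable_deriv _).comp measurable_fst
      fun_prop
    exact (h1.mul continuous_snd.aestronglyMeasurable).mul h2.aestronglyMeasurable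
  · filter_upwards [ae_squareMeasure] with q ⟨hq1, hq2⟩
    have h1 : ‖(γ.path q.1 - z) μ‖ ≤ R :=
      (PiLp.norm_apply_le _ μ).trans (hR q.1 (Ioo_subset_Icc_self hq1))
    have h2 : ‖deriv γ.path q.1 ν‖ ≤ K :=
      (PiLp.norm_apply_le _ ν).trans
        (norm_deriv_le_of_lipschitzOn (Icc_mem_nhds hq1.1 hq1.2) hK)
    have h3 : ‖q.2‖ ≤ 1 := by rw [Real.norm_of_nonneg hq2.1]; exact hq2.2
    rw [Simplex.coneWeight, norm_mul, norm_mul]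
    have h4 : ‖(γ.path q.1 - z) μ‖ * ‖q.2‖ ≤ R := by
      nlinarith [norm_nonneg ((γ.path q.1 - z) μ), norm_nonneg q.2]
    exact mul_le_mul h4 h2 (norm_nonneg _) ((mul_nonneg (norm_nonneg _) (norm_nonneg _)).trans h4)

/-! ## Smearing of surfaces and curves -/

/-- The test function `σ[f]^{μν}(x) = ∫_{Δ_2} f(x - σ(t)) σ^{μν}(t) d²t`. -/
def surfaceKernel (σ : Simplex 2) (f : TestFn) (μ ν : Fin 4) : TestFn :=
  mkSmear (m := volume.restrict (Delta 2)) (p := σ.ext) (w := σ.areaElement μ ν)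
    (by
      obtain ⟨K, hK⟩ := σ.exists_lipschitzOnWith
      exact hK.continuousOn.aestronglyMeasurable (isCompact_Delta 2).measurableSet)
    (σ.integrable_areaElement μ ν)
    (by
      obtain ⟨R, hR⟩ := σ.exists_bound
      refine ⟨R, ?_⟩
      filter_upwards [ae_restrict_mem (isCompact_Delta 2).measurableSet] with t ht using hR t ht)
    f (fun x => ∫ t in Delta 2, f (x - σ.ext t) * σ.areaElement μ ν t)
    (fun x => by simp only [smul_eq_mul, mul_comm])

/-- The test function
`γ_f^{z,μν}(x) = ∫₀¹ (∫₀¹ (γ(s) - z)^μ t f(x - (z + t (γ(s) - z))) dt) (dγ/ds)^ν ds`. -/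
def lineKernel (z : Spacetime) (γ : Simplex 1) (f : TestFn) (μ ν : Fin 4) : TestFn :=
  mkSmear (m := squareMeasure) (p := γ.conePoint z) (w := γ.coneWeight z μ ν)
    (γ.aestronglyMeasurable_conePoint z) (γ.integrable_coneWeight z μ ν) (γ.conePoint_bound z)
    f (fun x => ∫ s in (0 : ℝ)..1,
      (∫ t in (0 : ℝ)..1, (γ.path s - z) μ * t * f (x - (z + t • (γ.path s - z))))
        * deriv γ.path s ν)
    (fun x => by
      have h := smear_integrable (γ.aestronglyMeasurable_conePoint z)
        (γ.integrable_coneWeight z μ ν) f x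
      rw [integral_prod _ h, intervalIntegral.integral_of_le zero_le_one]
      refine integral_congr_ae (Filter.Eventually.of_forall fun s => ?_)
      simp only [intervalIntegral.integral_of_le zero_le_one, Simplex.coneWeight,
        Simplex.conePoint, smul_eq_mul]
      rw [← integral_mul_const]
      refine integral_congr_ae (Filter.Eventually.of_forall fun t => ?_)
      simp only
      ring)

section Integrals

variable {ℋ : Type*} [NormedAddCommGroup ℋ] [InnerProductSpace ℂ ℋ] [CompleteSpace ℋ]

/-- The surface integral `F⟨σ,f⟩ = 1/2 F_{μν}(σ[f]^{μν})` of the field. -/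
def QuantumEMField.surfaceIntegral (Φ : QuantumEMField ℋ) (σ : Simplex 2) (f : TestFn) :
    Φ.D →ₗ[ℂ] Φ.D :=
  (1 / 2 : ℂ) • ∑ μ, ∑ ν, Φ.F μ ν (surfaceKernel σ f μ ν)

/-- The line integral `A^z⟨γ,f⟩ = F_{μν}(γ_f^{z,μν})` of the potential form with pole `z`. -/
def QuantumEMField.lineIntegral (Φ : QuantumEMField ℋ) (z : Spacetime) (γ : Simplex 1)
    (f : TestFn) : Φ.D →ₗ[ℂ] Φ.D :=
  ∑ μ, ∑ ν, Φ.F μ ν (lineKernel z γ f μ ν)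

/-- The additive extension of the line integral to 1-chains. -/
def QuantumEMField.chainLineIntegral (Φ : QuantumEMField ℋ) (z : Spacetime) (c : Chain 1)
    (f : TestFn) : Φ.D →ₗ[ℂ] Φ.D :=
  c.sum fun γ k => k • Φ.lineIntegral z γ f

end Integrals

end QED

end

namespace QED

open Filter Topology

/-! The core is the Poincaré homotopy formula. A closed two-form `F` equals `dA` for the potential
`A_ν(y) = ∫₀¹ τ (y - z)^μ F_{μν}(z + τ (y - z)) dτ`, the error being a contraction of `dF` along the
rays from `z`; Stokes' theorem for `A` then compares the two integrals. As the field is a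
distribution, this argument is transposed to the test functions.

The transposed formula is `sum_lineKernel_face_sub`: the antisymmetrised line kernel of `∂σ` is the
surface kernel of `σ` plus the divergence of `volumeKernel`, a smearing of `f` over the cone with
apex `z` over `σ`. That kernel is cyclic in its three indices, so the first Maxwell equation kills
its divergence (`sum_F_lineDeriv_eq_zero`). Antisymmetrising doubles the value of the field
(`sum_F_sub`), which cancels the factor `1/2` of the surface integral.

The kernel formula comes from Stokes' theorem on `σ` for the one-forms `τ f(x - (z + τ (y - z))) (y
- z)^μ dy^ν` with `τ` fixed, integrated over `τ`. The surface kernel is put in the same shape by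
writing its integrand as the integral of `d/dτ (τ² f)` along each ray
(`integral_radial_derivative`); the integrands then agree pointwise.

Stokes' theorem is needed for `σ` that is merely Lipschitz, where `d² = 0` cannot be checked by
second derivatives. Green's theorem on the square is therefore proved first with difference
quotients, for which it is an exact telescoping identity. Rademacher's theorem and dominated
convergence give the limit, and a polar-type map collapses the square onto the triangle. -/

/-! ## Green's theorem for Lipschitz functions on the unit square -/

/-- The retraction of the real line onto the unit interval. -/
def clamp (x : ℝ) : ℝ := max 0 (min x 1)

theorem clamp_mem (x : ℝ) : clamp x ∈ Icc (0 : ℝ) 1 :=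
  ⟨le_max_left _ _, max_le zero_le_one (min_le_right _ _)⟩

theorem clamp_of_mem {x : ℝ} (hx : x ∈ Icc (0 : ℝ) 1) : clamp x = x := by
  rw [clamp, min_eq_left hx.2, max_eq_right hx.1]

theorem clamp_of_le {x : ℝ} (hx : x ≤ 0) : clamp x = 0 :=
  max_eq_left ((min_le_left _ _).trans hx)

theorem clamp_of_ge {x : ℝ} (hx : 1 ≤ x) : clamp x = 1 := by
  rw [clamp, min_eq_right hx, max_eq_right zero_le_one]

theorem lipschitzWith_clamp : LipschitzWith 1 clamp :=
  (LipschitzWith.id.min_const 1).const_max 0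

/-- Telescoping: the difference of the two shifted integrals leaves only the strips `[v, v + h]` and
`[u, u + h]`, where `g` is constant. This is the exact substitute for the fundamental theorem of
calculus. -/
theorem intervalIntegral_sub_comp_add {g : ℝ → ℝ} (hg : Continuous g) {u v h : ℝ} (hh : 0 ≤ h)
    (hu : ∀ x ∈ Icc u (u + h), g x = g u) (hv : ∀ x ∈ Icc v (v + h), g x = g v) :
    ∫ x in u..v, (g (x + h) - g x) = h * (g v - g u) := by
  have hi : ∀ s t, IntervalIntegrable g volume s t := fun s t => hg.intervalIntegrable s t
  rw [intervalIntegral.integral_sub (Continuous.intervalIntegrable (by fun_prop) _ _) (hi _ _),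
    intervalIntegral.integral_comp_add_right,
    intervalIntegral.integral_interval_sub_interval_comm' (hi _ _) (hi _ _) (hi _ _)]
  have h1 : ∀ w, (∀ x ∈ Icc w (w + h), g x = g w) → ∫ x in w..(w + h), g x = h * g w := by
    intro w hw
    rw [intervalIntegral.integral_congr (g := fun _ => g w)
      (fun x hx => hw x (by rwa [uIcc_of_le (by linarith)] at hx))]
    simp
  rw [h1 v hv, h1 u hu]
  ring

/-- The discrete version of `∂₁ (a ∂₂ b) - ∂₂ (a ∂₁ b)`, with step size `h`. -/
noncomputable def discreteJacobian (a b : ℝ × ℝ → ℝ) (h : ℝ) (p : ℝ × ℝ) : ℝ :=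
  (h⁻¹ * (a (p + h • (1, 0)) - a p)) *
      (h⁻¹ * (b (p + h • (1, 1)) - b p) - h⁻¹ * (b (p + h • (1, 0)) - b p)) -
    (h⁻¹ * (a (p + h • (0, 1)) - a p)) *
      (h⁻¹ * (b (p + h • (1, 1)) - b p) - h⁻¹ * (b (p + h • (0, 1)) - b p))

/-- The Jacobian determinant of the map `(a, b)`. -/
noncomputable def jacobian (a b : ℝ × ℝ → ℝ) (p : ℝ × ℝ) : ℝ :=
  fderiv ℝ a p (1, 0) * fderiv ℝ b p (0, 1) - fderiv ℝ a p (0, 1) * fderiv ℝ b p (1, 0)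

theorem tendsto_discreteJacobian {a b : ℝ × ℝ → ℝ} {p : ℝ × ℝ} (ha : DifferentiableAt ℝ a p)
    (hb : DifferentiableAt ℝ b p) :
    Tendsto (fun h => discreteJacobian a b h p) (𝓝[>] 0) (𝓝 (jacobian a b p)) := by
  have hs : ∀ {c : ℝ × ℝ → ℝ}, DifferentiableAt ℝ c p → ∀ v,
      Tendsto (fun h : ℝ => h⁻¹ * (c (p + h • v) - c p)) (𝓝[>] 0) (𝓝 (fderiv ℝ c p v)) :=
    fun hc v => (hc.hasFDerivAt.hasLineDerivAt v).tendsto_slope_zero_right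
  -- All slopes are based at the fixed point `p`, so differentiability at `p` suffices; the slope of
  -- `b` at the shifted point is recovered from linearity of the derivative on the diagonal.
  have e : fderiv ℝ b p (1, 1) = fderiv ℝ b p (1, 0) + fderiv ℝ b p (0, 1) := by
    rw [← map_add]
    simp
  have h1 := ((hs ha (1, 0)).mul ((hs hb (1, 1)).sub (hs hb (1, 0)))).sub
    ((hs ha (0, 1)).mul ((hs hb (1, 1)).sub (hs hb (0, 1))))
  rw [e, add_sub_cancel_left, add_sub_cancel_right] at h1
  exact h1

theorem abs_slope_le {K : NNReal} {c : ℝ × ℝ → ℝ} (hc : LipschitzWith K c)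
    {h : ℝ} (hh : 0 < h) (p v : ℝ × ℝ) (hv : ‖v‖ ≤ 1) : |h⁻¹ * (c (p + h • v) - c p)| ≤ K := by
  have h1 := hc.dist_le_mul (p + h • v) p
  rw [Real.dist_eq, dist_eq_norm, add_sub_cancel_left, norm_smul, Real.norm_of_nonneg hh.le] at h1
  rw [abs_mul, abs_of_pos (inv_pos.2 hh), inv_mul_le_iff₀ hh]
  refine h1.trans ?_
  have : (K : ℝ) * h * ‖v‖ ≤ K * h * 1 := by gcongr
  nlinarith

theorem abs_discreteJacobian_le {K L : NNReal} {a b : ℝ × ℝ → ℝ} (ha : LipschitzWith K a)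
    (hb : LipschitzWith L b) {h : ℝ} (hh : 0 < h) (p : ℝ × ℝ) :
    |discreteJacobian a b h p| ≤ K * (L + L) + K * (L + L) := by
  have e1 : ‖((1 : ℝ), (0 : ℝ))‖ ≤ 1 := by simp [Prod.norm_def]
  have e2 : ‖((0 : ℝ), (1 : ℝ))‖ ≤ 1 := by simp [Prod.norm_def]
  have e3 : ‖((1 : ℝ), (1 : ℝ))‖ ≤ 1 := by simp [Prod.norm_def]
  have hsub : ∀ {x y : ℝ}, |x| ≤ L → |y| ≤ L → |x - y| ≤ L + L := fun hx hy =>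
    (abs_sub _ _).trans (add_le_add hx hy)
  have hmul : ∀ {x y : ℝ}, |x| ≤ K → |y| ≤ L + L → |x * y| ≤ K * (L + L) := fun hx hy =>
    (abs_mul _ _).trans_le (mul_le_mul hx hy (abs_nonneg _) K.2)
  exact (abs_sub _ _).trans (add_le_add
    (hmul (abs_slope_le ha hh _ _ e1) (hsub (abs_slope_le hb hh _ _ e3) (abs_slope_le hb hh _ _ e1)))
    (hmul (abs_slope_le ha hh _ _ e2) (hsub (abs_slope_le hb hh _ _ e3) (abs_slope_le hb hh _ _ e2))))

/-- Discrete product rule: in the differences of `a D₂b` and `a D₁b` the mixed second differences of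
`b` cancel exactly, leaving `discreteJacobian`. The box exceeds the square by one unit on each side,
so for `h ≤ 1` the clamped functions are constant across the strips that telescoping leaves over. -/
theorem integral_discreteJacobian {a b : ℝ × ℝ → ℝ} (ha : Continuous a) (hb : Continuous b)
    (ha' : ∀ x y, a (x, y) = a (clamp x, clamp y)) (hb' : ∀ x y, b (x, y) = b (clamp x, clamp y))
    {h : ℝ} (hh : 0 < h) (hh1 : h ≤ 1) :
    ∫ p in Ioc (-1 : ℝ) 2 ×ˢ Ioc (-1 : ℝ) 2, discreteJacobian a b h p =
      (∫ y in (-1 : ℝ)..2, (a (1, y) * (h⁻¹ * (b (1, y + h) - b (1, y))) -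
        a (0, y) * (h⁻¹ * (b (0, y + h) - b (0, y))))) -
      ∫ x in (-1 : ℝ)..2, (a (x, 1) * (h⁻¹ * (b (x + h, 1) - b (x, 1))) -
        a (x, 0) * (h⁻¹ * (b (x + h, 0) - b (x, 0)))) := by
  have hx : ∀ {c : ℝ × ℝ → ℝ}, (∀ x y, c (x, y) = c (clamp x, clamp y)) → ∀ x y,
      (x ≤ 0 → c (x, y) = c (0, y)) ∧ (1 ≤ x → c (x, y) = c (1, y)) ∧
      (y ≤ 0 → c (x, y) = c (x, 0)) ∧ (1 ≤ y → c (x, y) = c (x, 1)) := by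
    intro c hc x y
    have c0 : clamp 0 = 0 := clamp_of_le le_rfl
    have c1 : clamp 1 = 1 := clamp_of_ge le_rfl
    refine ⟨fun h => ?_, fun h => ?_, fun h => ?_, fun h => ?_⟩
    · rw [hc x y, hc 0 y, clamp_of_le h, c0]
    · rw [hc x y, hc 1 y, clamp_of_ge h, c1]
    · rw [hc x y, hc x 0, clamp_of_le h, c0]
    · rw [hc x y, hc x 1, clamp_of_ge h, c1]
  let G : ℝ → ℝ → ℝ := fun x y => a (x, y) * (h⁻¹ * (b (x, y + h) - b (x, y)))
  let H : ℝ → ℝ → ℝ := fun y x => a (x, y) * (h⁻¹ * (b (x + h, y) - b (x, y)))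
  -- The terms with a second difference of `b` occur in both quotients, with opposite signs.
  have hsplit : ∀ p : ℝ × ℝ, discreteJacobian a b h p =
      h⁻¹ * (G (p.1 + h) p.2 - G p.1 p.2) - h⁻¹ * (H (p.2 + h) p.1 - H p.2 p.1) := by
    rintro ⟨x, y⟩
    simp only [discreteJacobian, G, H, Prod.smul_mk, Prod.mk_add_mk, smul_eq_mul, mul_one, mul_zero,
      add_zero]
    ring
  have hc1 : Continuous fun p : ℝ × ℝ => h⁻¹ * (G (p.1 + h) p.2 - G p.1 p.2) := by
    simp only [G]; fun_prop
  have hc2 : Continuous fun p : ℝ × ℝ => h⁻¹ * (H (p.2 + h) p.1 - H p.2 p.1) := by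
    simp only [H]; fun_prop
  have hint : ∀ {g : ℝ × ℝ → ℝ}, Continuous g →
      IntegrableOn g (Ioc (-1 : ℝ) 2 ×ˢ Ioc (-1 : ℝ) 2) (volume.prod volume) := fun hg =>
    (hg.continuousOn.integrableOn_compact (isCompact_Icc.prod isCompact_Icc)).mono_set
      (prod_mono Ioc_subset_Icc_self Ioc_subset_Icc_self)
  have e1 : ∫ p in Ioc (-1 : ℝ) 2 ×ˢ Ioc (-1 : ℝ) 2, h⁻¹ * (G (p.1 + h) p.2 - G p.1 p.2) =
      ∫ y in (-1 : ℝ)..2, (G 1 y - G 0 y) := by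
    rw [Measure.volume_eq_prod, ← setIntegral_prod_swap,
      setIntegral_prod (fun p => h⁻¹ * (G (p.swap.1 + h) p.swap.2 - G p.swap.1 p.swap.2))
        (hint (hc1.comp continuous_swap)),
      intervalIntegral.integral_of_le (by norm_num)]
    refine integral_congr_ae (Eventually.of_forall fun y => ?_)
    simp only [Prod.swap_prod_mk]
    rw [← intervalIntegral.integral_of_le (by norm_num), intervalIntegral.integral_const_mul,
      intervalIntegral_sub_comp_add (g := fun x => G x y) (by simp only [G]; fun_prop) hh.le]
    · have e2 : G 2 y = G 1 y := by
        simp only [G, (hx ha' 2 y).2.1 one_le_two, (hx hb' 2 _).2.1 one_le_two]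
      have e3 : G (-1) y = G 0 y := by
        simp only [G, (hx ha' (-1) y).1 (by norm_num), (hx hb' (-1) _).1 (by norm_num)]
      rw [e2, e3, inv_mul_cancel_left₀ hh.ne']
    · rintro x ⟨h1, h2⟩
      simp only [G, (hx ha' x y).1 (by linarith), (hx hb' x _).1 (by linarith),
        (hx ha' (-1) y).1 (by norm_num), (hx hb' (-1) _).1 (by norm_num)]
    · rintro x ⟨h1, h2⟩
      simp only [G, (hx ha' x y).2.1 (by linarith), (hx hb' x _).2.1 (by linarith),
        (hx ha' 2 y).2.1 one_le_two, (hx hb' 2 _).2.1 one_le_two]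
  have e2 : ∫ p in Ioc (-1 : ℝ) 2 ×ˢ Ioc (-1 : ℝ) 2, h⁻¹ * (H (p.2 + h) p.1 - H p.2 p.1) =
      ∫ x in (-1 : ℝ)..2, (H 1 x - H 0 x) := by
    rw [Measure.volume_eq_prod, setIntegral_prod _ (hint hc2),
      intervalIntegral.integral_of_le (by norm_num)]
    refine integral_congr_ae (Eventually.of_forall fun y => ?_)
    simp only
    rw [← intervalIntegral.integral_of_le (by norm_num), intervalIntegral.integral_const_mul,
      intervalIntegral_sub_comp_add (g := fun x => H x y) (by simp only [H]; fun_prop) hh.le]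
    · have e2 : H 2 y = H 1 y := by
        simp only [H, (hx ha' y 2).2.2.2 one_le_two, (hx hb' _ 2).2.2.2 one_le_two]
      have e3 : H (-1) y = H 0 y := by
        simp only [H, (hx ha' y (-1)).2.2.1 (by norm_num), (hx hb' _ (-1)).2.2.1 (by norm_num)]
      rw [e2, e3, inv_mul_cancel_left₀ hh.ne']
    · rintro x ⟨h1, h2⟩
      simp only [H, (hx ha' y x).2.2.1 (by linarith), (hx hb' _ x).2.2.1 (by linarith),
        (hx ha' y (-1)).2.2.1 (by norm_num), (hx hb' _ (-1)).2.2.1 (by norm_num)]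
    · rintro x ⟨h1, h2⟩
      simp only [H, (hx ha' y x).2.2.2 (by linarith), (hx hb' _ x).2.2.2 (by linarith),
        (hx ha' y 2).2.2.2 one_le_two, (hx hb' _ 2).2.2.2 one_le_two]
  simp only [hsplit]
  rw [Measure.volume_eq_prod, integral_sub (hint hc1) (hint hc2), ← Measure.volume_eq_prod, e1, e2]

/-- The slopes are bounded by the Lipschitz constant and converge almost everywhere by Rademacher's
theorem, so convergence is dominated. -/
theorem tendsto_integral_mul_slope {K : NNReal} {α β : ℝ → ℝ} (hα : Continuous α)
    (hβ : LipschitzWith K β) (u v : ℝ) :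
    Tendsto (fun h : ℝ => ∫ y in u..v, α y * (h⁻¹ * (β (y + h) - β y))) (𝓝[>] 0)
      (𝓝 (∫ y in u..v, α y * deriv β y)) := by
  refine intervalIntegral.tendsto_integral_filter_of_dominated_convergence (fun y => |α y| * K)
    (Eventually.of_forall fun h => ?_) ?_ ?_ ?_
  · have := hβ.continuous
    exact Continuous.aestronglyMeasurable (by fun_prop)
  · filter_upwards [self_mem_nhdsWithin] with h (hh : 0 < h)
    refine Eventually.of_forall fun y _ => ?_
    rw [norm_mul, Real.norm_eq_abs]
    gcongr
    have h1 := hβ.dist_le_mul (y + h) y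
    rw [Real.dist_eq, Real.dist_eq, add_sub_cancel_left, abs_of_pos hh] at h1
    rw [norm_mul, Real.norm_of_nonneg (inv_pos.2 hh).le, inv_mul_le_iff₀ hh, Real.norm_eq_abs]
    linarith
  · exact Continuous.intervalIntegrable (by fun_prop) _ _
  · filter_upwards [hβ.ae_differentiableAt_real] with y hy _
    refine tendsto_const_nhds.mul ?_
    simpa using hy.hasDerivAt.tendsto_slope_zero_right

/-- Both sides of the discrete identity converge as `h → 0⁺`, so the limits agree. -/
theorem integral_box_jacobian {K L : NNReal} {a b : ℝ × ℝ → ℝ} (ha : LipschitzWith K a)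
    (hb : LipschitzWith L b)
    (ha' : ∀ x y, a (x, y) = a (clamp x, clamp y)) (hb' : ∀ x y, b (x, y) = b (clamp x, clamp y)) :
    ∫ p in Ioc (-1 : ℝ) 2 ×ˢ Ioc (-1 : ℝ) 2, jacobian a b p =
      ((∫ y in (-1 : ℝ)..2, a (1, y) * deriv (fun y => b (1, y)) y) -
        ∫ y in (-1 : ℝ)..2, a (0, y) * deriv (fun y => b (0, y)) y) -
      ((∫ x in (-1 : ℝ)..2, a (x, 1) * deriv (fun x => b (x, 1)) x) -
        ∫ x in (-1 : ℝ)..2, a (x, 0) * deriv (fun x => b (x, 0)) x) := by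
  have hac := ha.continuous
  have hbc := hb.continuous
  have hl : Tendsto (fun h => ∫ p in Ioc (-1 : ℝ) 2 ×ˢ Ioc (-1 : ℝ) 2, discreteJacobian a b h p)
      (𝓝[>] 0) (𝓝 (∫ p in Ioc (-1 : ℝ) 2 ×ˢ Ioc (-1 : ℝ) 2, jacobian a b p)) := by
    refine tendsto_integral_filter_of_dominated_convergence
      (fun _ => (K * (L + L) + K * (L + L) : ℝ)) (Eventually.of_forall fun h => ?_) ?_ ?_ ?_
    · exact Continuous.aestronglyMeasurable (by unfold discreteJacobian; fun_prop)
    · filter_upwards [self_mem_nhdsWithin] with h hh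
      exact Eventually.of_forall fun p => abs_discreteJacobian_le ha hb hh p
    · refine integrableOn_const ?_
      exact ((isCompact_Icc.prod isCompact_Icc).measure_lt_top.trans_le' (measure_mono
        (prod_mono Ioc_subset_Icc_self Ioc_subset_Icc_self))).ne
    · filter_upwards [ae_restrict_of_ae (ha.ae_differentiableAt (μ := volume)),
        ae_restrict_of_ae (hb.ae_differentiableAt (μ := volume))] with p h1 h2
      exact tendsto_discreteJacobian h1 h2
  have hv : ∀ x, LipschitzWith L fun y => b (x, y) := fun x => by
    simpa [Function.comp_def] using hb.comp (LipschitzWith.prodMk_left x)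
  have hh : ∀ y, LipschitzWith L fun x => b (x, y) := fun y => by
    simpa [Function.comp_def] using hb.comp (LipschitzWith.prodMk_right y)
  have hr := ((tendsto_integral_mul_slope (α := fun y => a (1, y)) (by fun_prop) (hv 1) (-1) 2).sub
    (tendsto_integral_mul_slope (α := fun y => a (0, y)) (by fun_prop) (hv 0) (-1) 2)).sub
    ((tendsto_integral_mul_slope (α := fun x => a (x, 1)) (by fun_prop) (hh 1) (-1) 2).sub
    (tendsto_integral_mul_slope (α := fun x => a (x, 0)) (by fun_prop) (hh 0) (-1) 2))
  refine tendsto_nhds_unique (hl.congr' ?_) hr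
  filter_upwards [Ioc_mem_nhdsGT (zero_lt_one' ℝ)] with h h01
  rw [integral_discreteJacobian hac hbc ha' hb' h01.1 h01.2,
    intervalIntegral.integral_sub, intervalIntegral.integral_sub] <;>
  exact Continuous.intervalIntegrable (by fun_prop) _ _

/-! ### From the enlarged box back to the unit square -/

theorem deriv_eq_zero_of_clamp {β : ℝ → ℝ} (hβ : ∀ x, β x = β (clamp x)) {x : ℝ}
    (hx : x < 0 ∨ 1 < x) : deriv β x = 0 := by
  rcases hx with hx | hx
  · have : β =ᶠ[𝓝 x] fun _ => β 0 := by
      filter_upwards [Iio_mem_nhds hx] with y hy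
      rw [hβ, clamp_of_le (le_of_lt hy)]
    rw [this.deriv_eq, deriv_const]
  · have : β =ᶠ[𝓝 x] fun _ => β 1 := by
      filter_upwards [Ioi_mem_nhds hx] with y hy
      rw [hβ, clamp_of_ge (le_of_lt hy)]
    rw [this.deriv_eq, deriv_const]

theorem intervalIntegral_mul_deriv_of_clamp {α β : ℝ → ℝ} (hβ : ∀ x, β x = β (clamp x)) :
    ∫ y in (-1 : ℝ)..2, α y * deriv β y = ∫ y in (0 : ℝ)..1, α y * deriv β y := by
  rw [intervalIntegral.integral_of_le (by norm_num), intervalIntegral.integral_of_le zero_le_one]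
  refine setIntegral_eq_of_subset_of_ae_sdiff_eq_zero measurableSet_Ioc.nullMeasurableSet
    (Ioc_subset_Ioc (by norm_num) (by norm_num)) ?_
  have h0 : ∀ᵐ x ∂(volume : Measure ℝ), x ≠ 0 := by simp [ae_iff]
  filter_upwards [h0] with x hx hx'
  rw [deriv_eq_zero_of_clamp hβ, mul_zero]
  by_contra h
  push Not at h
  exact hx'.2 ⟨lt_of_le_of_ne h.1 hx.symm, h.2⟩

theorem fderiv_fst_eq_zero_of_clamp {c : ℝ × ℝ → ℝ}
    (hc : ∀ x y, c (x, y) = c (clamp x, clamp y)) {p : ℝ × ℝ} (hp : p.1 < 0 ∨ 1 < p.1) :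
    fderiv ℝ c p (1, 0) = 0 := by
  by_cases hd : DifferentiableAt ℝ c p
  · have h1 : HasDerivAt (fun x : ℝ => (x, p.2)) ((1 : ℝ), (0 : ℝ)) p.1 :=
      (hasDerivAt_id p.1).prodMk (hasDerivAt_const _ _)
    have h2 := (show HasFDerivAt c (fderiv ℝ c p) (p.1, p.2) from
      hd.hasFDerivAt).comp_hasDerivAt p.1 h1
    rw [← h2.deriv]
    refine deriv_eq_zero_of_clamp (fun x => ?_) hp
    simp only [Function.comp]
    rw [hc, hc (clamp x) p.2, clamp_of_mem (clamp_mem x)]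
  -- At a point of non-differentiability the total derivative has the default value `0`.
  · simp [fderiv_zero_of_not_differentiableAt hd]

theorem fderiv_snd_eq_zero_of_clamp {c : ℝ × ℝ → ℝ}
    (hc : ∀ x y, c (x, y) = c (clamp x, clamp y)) {p : ℝ × ℝ} (hp : p.2 < 0 ∨ 1 < p.2) :
    fderiv ℝ c p (0, 1) = 0 := by
  by_cases hd : DifferentiableAt ℝ c p
  · have h1 : HasDerivAt (fun y : ℝ => (p.1, y)) ((0 : ℝ), (1 : ℝ)) p.2 :=
      (hasDerivAt_const _ _).prodMk (hasDerivAt_id p.2)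
    have h2 := (show HasFDerivAt c (fderiv ℝ c p) (p.1, p.2) from
      hd.hasFDerivAt).comp_hasDerivAt p.2 h1
    rw [← h2.deriv]
    refine deriv_eq_zero_of_clamp (fun x => ?_) hp
    simp only [Function.comp]
    rw [hc, hc p.1 (clamp x), clamp_of_mem (clamp_mem x)]
  · simp [fderiv_zero_of_not_differentiableAt hd]

/-- Green's theorem on the unit square, for Lipschitz functions. -/
theorem integral_square_jacobian {K L : NNReal} {a b : ℝ × ℝ → ℝ} (ha : LipschitzWith K a)
    (hb : LipschitzWith L b)
    (ha' : ∀ x y, a (x, y) = a (clamp x, clamp y)) (hb' : ∀ x y, b (x, y) = b (clamp x, clamp y)) :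
    ∫ p in Ioo (0 : ℝ) 1 ×ˢ Ioo (0 : ℝ) 1, jacobian a b p =
      ((∫ y in (0 : ℝ)..1, a (1, y) * deriv (fun y => b (1, y)) y) -
        ∫ y in (0 : ℝ)..1, a (0, y) * deriv (fun y => b (0, y)) y) -
      ((∫ x in (0 : ℝ)..1, a (x, 1) * deriv (fun x => b (x, 1)) x) -
        ∫ x in (0 : ℝ)..1, a (x, 0) * deriv (fun x => b (x, 0)) x) := by
  have hv : ∀ x y, b (x, y) = b (x, clamp y) := fun x y => by
    rw [hb', hb' x (clamp y), clamp_of_mem (clamp_mem y)]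
  have hh : ∀ y x, b (x, y) = b (clamp x, y) := fun y x => by
    rw [hb', hb' (clamp x) y, clamp_of_mem (clamp_mem x)]
  rw [← intervalIntegral_mul_deriv_of_clamp (hv 1), ← intervalIntegral_mul_deriv_of_clamp (hv 0),
    ← intervalIntegral_mul_deriv_of_clamp (hh 1), ← intervalIntegral_mul_deriv_of_clamp (hh 0),
    ← integral_box_jacobian ha hb ha' hb']
  symm
  refine setIntegral_eq_of_subset_of_ae_sdiff_eq_zero
    (measurableSet_Ioc.prod measurableSet_Ioc).nullMeasurableSet
    (prod_mono (Ioo_subset_Ioc_self.trans (Ioc_subset_Ioc (by norm_num) (by norm_num)))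
      (Ioo_subset_Ioc_self.trans (Ioc_subset_Ioc (by norm_num) (by norm_num)))) ?_
  have hne : ∀ c : ℝ, ∀ᵐ x ∂(volume : Measure ℝ), x ≠ c := fun c => by simp [ae_iff]
  have h1 : ∀ c : ℝ, ∀ᵐ p ∂(volume : Measure (ℝ × ℝ)), p.1 ≠ c := fun c =>
    Measure.quasiMeasurePreserving_fst.ae (hne c)
  have h2 : ∀ c : ℝ, ∀ᵐ p ∂(volume : Measure (ℝ × ℝ)), p.2 ≠ c := fun c =>
    Measure.quasiMeasurePreserving_snd.ae (hne c)
  filter_upwards [h1 0, h1 1, h2 0, h2 1] with p h10 h11 h20 h21 hp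
  rw [jacobian]
  -- Outside the square one coordinate is clamped to a constant, so both functions lose that partial
  -- derivative and the determinant vanishes.
  by_cases h : p.1 < 0 ∨ 1 < p.1
  · rw [fderiv_fst_eq_zero_of_clamp ha' h, fderiv_fst_eq_zero_of_clamp hb' h]
    ring
  by_cases h' : p.2 < 0 ∨ 1 < p.2
  · rw [fderiv_snd_eq_zero_of_clamp ha' h', fderiv_snd_eq_zero_of_clamp hb' h']
    ring
  push Not at h h'
  exact (hp.2 ⟨⟨lt_of_le_of_ne h.1 h10.symm, lt_of_le_of_ne h.2 h11⟩,
    ⟨lt_of_le_of_ne h'.1 h20.symm, lt_of_le_of_ne h'.2 h21⟩⟩).elim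

/-! ## Green's theorem for Lipschitz functions on the standard triangle -/

/-- The collapse of the unit square onto the standard triangle. -/
def duffy (q : ℝ × ℝ) : Fin 2 → ℝ := ![q.1 * (1 - q.2), q.1 * q.2]

theorem contDiff_duffy : ContDiff ℝ 1 duffy := by
  refine contDiff_pi.2 fun i => ?_
  fin_cases i <;> simp only [duffy] <;> simp <;> fun_prop

theorem hasFDerivAt_duffy (q : ℝ × ℝ) :
    HasFDerivAt duffy (ContinuousLinearMap.pi
      ![(1 - q.2) • ContinuousLinearMap.fst ℝ ℝ ℝ - q.1 • ContinuousLinearMap.snd ℝ ℝ ℝ,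
        q.2 • ContinuousLinearMap.fst ℝ ℝ ℝ + q.1 • ContinuousLinearMap.snd ℝ ℝ ℝ]) q := by
  have h1 : HasFDerivAt (fun q : ℝ × ℝ => q.1) (ContinuousLinearMap.fst ℝ ℝ ℝ) q := hasFDerivAt_fst
  have h2 : HasFDerivAt (fun q : ℝ × ℝ => q.2) (ContinuousLinearMap.snd ℝ ℝ ℝ) q := hasFDerivAt_snd
  refine hasFDerivAt_pi.2 fun i => ?_
  fin_cases i
  · refine (h1.mul (h2.const_sub 1)).congr_fderiv ?_
    ext <;> simp
  · refine (h1.mul h2).congr_fderiv ?_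
    ext <;> simp

theorem duffy_mem_Delta {q : ℝ × ℝ} (h1 : q.1 ∈ Icc (0 : ℝ) 1) (h2 : q.2 ∈ Icc (0 : ℝ) 1) :
    duffy q ∈ Delta 2 := by
  refine ⟨fun i => ?_, ?_⟩
  · fin_cases i
    · exact mul_nonneg h1.1 (sub_nonneg.2 h2.2)
    · exact mul_nonneg h1.1 h2.1
  · simp only [duffy, Fin.sum_univ_two, Matrix.cons_val_zero, Matrix.cons_val_one]
    linarith [h1.2]

/-- The inverse of `duffy` away from the collapsed side. -/
noncomputable def duffyInv (t : Fin 2 → ℝ) : Fin 2 → ℝ := ![t 0 + t 1, t 1 / (t 0 + t 1)]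

theorem duffyInv_duffy {q : ℝ × ℝ} (h : q.1 ≠ 0) : duffyInv (duffy q) = ![q.1, q.2] := by
  have e : q.1 * (1 - q.2) + q.1 * q.2 = q.1 := by ring
  simp [duffyInv, duffy, e, h]

theorem duffy_duffyInv {t : Fin 2 → ℝ} (h : t 0 + t 1 ≠ 0) :
    duffy (duffyInv t 0, duffyInv t 1) = t := by
  ext i
  fin_cases i
  · simp only [duffyInv, duffy]
    simp
    field_simp
    ring
  · simp only [duffyInv, duffy]
    simp
    field_simp

theorem lipschitzWith_comp_duffy {E : Type*} [PseudoMetricSpace E] {K : NNReal}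
    {α : (Fin 2 → ℝ) → E} (hα : LipschitzOnWith K α (Delta 2)) :
    ∃ L, LipschitzWith L fun q : ℝ × ℝ => α (duffy (clamp q.1, clamp q.2)) := by
  obtain ⟨M, hM⟩ := contDiff_duffy.locallyLipschitz.locallyLipschitzOn
    (s := Icc (0 : ℝ) 1 ×ˢ Icc (0 : ℝ) 1) |>.exists_lipschitzOnWith_of_compact
    (isCompact_Icc.prod isCompact_Icc)
  have hc : LipschitzWith (max (1 * 1) (1 * 1)) fun q : ℝ × ℝ => (clamp q.1, clamp q.2) :=
    (lipschitzWith_clamp.comp LipschitzWith.prod_fst).prodMk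
      (lipschitzWith_clamp.comp LipschitzWith.prod_snd)
  have h1 := hα.comp hM (fun q hq => duffy_mem_Delta hq.1 hq.2)
  have h2 := h1.comp (hc.lipschitzOnWith (s := univ)) (fun q _ => ⟨clamp_mem _, clamp_mem _⟩)
  exact ⟨_, lipschitzOnWith_univ.1 h2⟩

theorem clamp_prod_eventuallyEq {q : ℝ × ℝ} (h1 : q.1 ∈ Ioo (0 : ℝ) 1) (h2 : q.2 ∈ Ioo (0 : ℝ) 1) :
    (fun q : ℝ × ℝ => (clamp q.1, clamp q.2)) =ᶠ[𝓝 q] id := by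
  filter_upwards [(isOpen_Ioo.prod isOpen_Ioo).mem_nhds (show q ∈ Ioo (0 : ℝ) 1 ×ˢ Ioo (0 : ℝ) 1
    from ⟨h1, h2⟩)] with p hp
  rw [clamp_of_mem (Ioo_subset_Icc_self hp.1), clamp_of_mem (Ioo_subset_Icc_self hp.2)]
  rfl

theorem fderiv_comp_duffy {α : (Fin 2 → ℝ) → ℝ} {q : ℝ × ℝ} (h1 : q.1 ∈ Ioo (0 : ℝ) 1)
    (h2 : q.2 ∈ Ioo (0 : ℝ) 1) (hα : DifferentiableAt ℝ α (duffy q)) :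
    fderiv ℝ (fun q : ℝ × ℝ => α (duffy (clamp q.1, clamp q.2))) q (1, 0) =
        (1 - q.2) * fderiv ℝ α (duffy q) (Pi.single 0 1) +
          q.2 * fderiv ℝ α (duffy q) (Pi.single 1 1) ∧
      fderiv ℝ (fun q : ℝ × ℝ => α (duffy (clamp q.1, clamp q.2))) q (0, 1) =
        -q.1 * fderiv ℝ α (duffy q) (Pi.single 0 1) +
          q.1 * fderiv ℝ α (duffy q) (Pi.single 1 1) := by
  have he : (fun q : ℝ × ℝ => α (duffy (clamp q.1, clamp q.2))) =ᶠ[𝓝 q] α ∘ duffy :=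
    (clamp_prod_eventuallyEq h1 h2).fun_comp (α ∘ duffy)
  have hv : ∀ c d : ℝ, fderiv ℝ α (duffy q) ![c, d] =
      c * fderiv ℝ α (duffy q) (Pi.single 0 1) + d * fderiv ℝ α (duffy q) (Pi.single 1 1) := by
    intro c d
    have : ![c, d] = c • Pi.single 0 1 + d • Pi.single 1 1 := by
      ext i
      fin_cases i <;> simp
    rw [this, map_add, map_smul, map_smul, smul_eq_mul, smul_eq_mul]
  rw [he.fderiv_eq, (hα.hasFDerivAt.comp q (hasFDerivAt_duffy q)).fderiv, ← hv, ← hv]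
  constructor <;>
  · rw [ContinuousLinearMap.comp_apply]
    congr 1
    ext i
    fin_cases i <;> simp

/-- Change of variables under `duffy`, whose Jacobian determinant is `q.1`. Injectivity fails only
on the side `q.1 = 0`, which collapses to the origin; both are null sets. -/
theorem setIntegral_Delta_eq (g : (Fin 2 → ℝ) → ℝ) :
    ∫ t in Delta 2, g t = ∫ q in Ioo (0 : ℝ) 1 ×ˢ Ioo (0 : ℝ) 1, q.1 * g (duffy q) := by
  let S : Set (ℝ × ℝ) := Ioc 0 1 ×ˢ Icc 0 1
  let e : (Fin 2 → ℝ) →L[ℝ] ℝ × ℝ :=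
    (ContinuousLinearMap.proj 0).prod (ContinuousLinearMap.proj 1)
  have hS : MeasurableSet S := measurableSet_Ioc.prod measurableSet_Icc
  have himg : (duffy ∘ e) '' (e ⁻¹' S) = Delta 2 \ {0} := by
    ext t
    constructor
    · rintro ⟨p, ⟨⟨hp1, hp2⟩, hp3⟩, rfl⟩
      refine ⟨duffy_mem_Delta ⟨hp1.le, hp2⟩ hp3, fun h => hp1.ne' ?_⟩
      have h0 : duffy (e p) = 0 := h
      have h1 := congrFun h0 0
      have h2 := congrFun h0 1
      simp [duffy] at h1 h2
      rcases h1 with h1 | h1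
      · exact h1
      · rcases h2 with h2 | h2
        · exact h2
        · linarith
    · rintro ⟨⟨h0, h1⟩, h2⟩
      rw [Fin.sum_univ_two] at h1
      have h3 : 0 < t 0 + t 1 := by
        refine lt_of_le_of_ne (add_nonneg (h0 0) (h0 1)) fun h => h2 ?_
        have h00 := h0 0
        have h01 := h0 1
        ext i
        fin_cases i <;> simp <;> linarith
      refine ⟨duffyInv t, ⟨⟨h3, h1⟩, div_nonneg (h0 1) h3.le, ?_⟩, duffy_duffyInv h3.ne'⟩
      exact (div_le_one h3).2 (by linarith [h0 0])
  have hinj : InjOn (duffy ∘ e) (e ⁻¹' S) := by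
    rintro p ⟨⟨hp, -⟩, -⟩ p' ⟨⟨hp', -⟩, -⟩ h
    have h1 := congrArg duffyInv h
    simp only [Function.comp] at h1
    rw [duffyInv_duffy hp.ne', duffyInv_duffy hp'.ne'] at h1
    ext i
    have := congrFun h1 i
    fin_cases i <;> simpa [e] using this
  have hd : ∀ p, ∃ D : (Fin 2 → ℝ) →L[ℝ] (Fin 2 → ℝ), HasFDerivAt (duffy ∘ e) D p ∧ D.det = p 0 := by
    intro p
    refine ⟨_, (hasFDerivAt_duffy (e p)).comp p e.hasFDerivAt, ?_⟩
    rw [ContinuousLinearMap.det, ← LinearMap.det_toMatrix', Matrix.det_fin_two]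
    simp [LinearMap.toMatrix'_apply, e]
    ring
  choose D hD hdet using hd
  have h0 : ∫ t in Delta 2, g t = ∫ t in Delta 2 \ {0}, g t :=
    setIntegral_congr_set (sdiff_null_ae_eq_self (measure_singleton 0)).symm
  rw [h0, ← himg, integral_image_eq_integral_abs_det_fderiv_smul volume
    (e.continuous.measurable hS) (fun p _ => (hD p).hasFDerivWithinAt) hinj]
  have h1 : ∫ p in e ⁻¹' S, |(D p).det| • g ((duffy ∘ e) p) =
      ∫ p in e ⁻¹' S, (fun q : ℝ × ℝ => |q.1| * g (duffy q)) (e p) :=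
    integral_congr_ae (Eventually.of_forall fun p => by simp [hdet, e])
  have h2 := (volume_preserving_finTwoArrow ℝ).setIntegral_preimage_emb
    MeasurableEquiv.finTwoArrow.measurableEmbedding (fun q : ℝ × ℝ => |q.1| * g (duffy q)) S
  have h3 : ∫ q in S, |q.1| * g (duffy q) =
      ∫ q in Ioo (0 : ℝ) 1 ×ˢ Ioo (0 : ℝ) 1, |q.1| * g (duffy q) :=
    setIntegral_congr_set (Measure.set_prod_ae_eq Ioo_ae_eq_Ioc Ioo_ae_eq_Icc).symm
  rw [h1]
  refine h2.trans (h3.trans ?_)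
  refine setIntegral_congr_fun (measurableSet_Ioo.prod measurableSet_Ioo) fun q hq => ?_
  simp only [abs_of_pos hq.1.1]

/-- Null sets must be pulled back along `duffy`. In the open square the preimage of a null set lies
in its image under `duffyInv`, and a differentiable map of `ℝ²` to itself sends null sets to null
sets. The locus `t 0 + t 1 = 0`, where `duffyInv` is singular, is not reached from the open square.
-/
theorem ae_duffy {P : (Fin 2 → ℝ) → Prop} (hP : ∀ᵐ t, t ∈ Delta 2 → P t) :
    ∀ᵐ q : ℝ × ℝ, q ∈ Ioo (0 : ℝ) 1 ×ˢ Ioo (0 : ℝ) 1 → P (duffy q) := by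
  let N : Set (Fin 2 → ℝ) := {t | ¬ (t ∈ Delta 2 → P t)} ∩ {t | t 0 + t 1 ≠ 0}
  have hN : volume N = 0 := measure_mono_null inter_subset_left (ae_iff.1 hP)
  have hdiff : DifferentiableOn ℝ duffyInv N := by
    refine differentiableOn_pi.2 fun i => ?_
    fin_cases i
    · simp only [duffyInv]
      simp
      fun_prop
    · simp only [duffyInv]
      simp
      have h1 : DifferentiableOn ℝ (fun t : Fin 2 → ℝ => t 1) N := by fun_prop
      have h2 : DifferentiableOn ℝ (fun t : Fin 2 → ℝ => t 0 + t 1) N := by fun_prop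
      simp only [div_eq_mul_inv]
      exact h1.mul (h2.inv fun t ht => ht.2)
  have hI := addHaar_image_eq_zero_of_differentiableOn_of_addHaar_eq_zero volume hdiff hN
  have h := (volume_preserving_finTwoArrow ℝ).symm.quasiMeasurePreserving.ae
    (measure_eq_zero_iff_ae_notMem.1 hI)
  filter_upwards [h] with q hq hq'
  by_contra hc
  refine hq ⟨duffy q, ⟨fun hh => hc (hh ?_), ?_⟩, ?_⟩
  · exact duffy_mem_Delta (Ioo_subset_Icc_self hq'.1) (Ioo_subset_Icc_self hq'.2)
  · have : duffy q 0 + duffy q 1 = q.1 := by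
      simp only [duffy, Matrix.cons_val_zero, Matrix.cons_val_one]
      ring
    simpa only [mem_ofPred_eq, this] using hq'.1.1.ne'
  · rw [duffyInv_duffy hq'.1.1.ne']
    ext i
    fin_cases i <;> rfl

/-- Rademacher's theorem gives differentiability within the simplex; at interior points this is full
differentiability, and the frontier of a convex set is null. -/
theorem ae_differentiableAt_of_lipschitzOnWith_Delta {E : Type*} [NormedAddCommGroup E]
    [NormedSpace ℝ E] [FiniteDimensional ℝ E] {n : ℕ} {K : NNReal}
    {α : (Fin n → ℝ) → E} (hα : LipschitzOnWith K α (Delta n)) :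
    ∀ᵐ t, t ∈ Delta n → DifferentiableAt ℝ α t := by
  have h0 : ∀ᵐ t ∂(volume : Measure (Fin n → ℝ)), t ∉ frontier (Delta n) :=
    measure_eq_zero_iff_ae_notMem.1 ((convex_Delta n).addHaar_frontier _)
  filter_upwards [hα.ae_differentiableWithinAt_of_mem (μ := volume), h0] with t h1 h2 ht
  have hi : t ∈ interior (Delta n) := by
    by_contra h
    exact h2 ⟨subset_closure ht, h⟩
  exact (h1 ht).differentiableAt (mem_interior_iff_mem_nhds.1 hi)

theorem intervalIntegral_mul_deriv_congr {α β α' β' : ℝ → ℝ}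
    (hα : ∀ s ∈ Ioo (0 : ℝ) 1, α s = α' s) (hβ : ∀ s ∈ Ioo (0 : ℝ) 1, β s = β' s) :
    ∫ s in (0 : ℝ)..1, α s * deriv β s = ∫ s in (0 : ℝ)..1, α' s * deriv β' s := by
  rw [intervalIntegral.integral_of_le zero_le_one, intervalIntegral.integral_of_le zero_le_one,
    integral_Ioc_eq_integral_Ioo, integral_Ioc_eq_integral_Ioo]
  refine setIntegral_congr_fun measurableSet_Ioo fun s hs => ?_
  have : β =ᶠ[𝓝 s] β' := by
    filter_upwards [isOpen_Ioo.mem_nhds hs] with y hy using hβ y hy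
  simp only [hα s hs, this.deriv_eq]

theorem faceIncl_one_dim (s : ℝ) :
    faceIncl (n := 1) 0 (fun _ => s) = ![1 - s, s] ∧ faceIncl (n := 1) 1 (fun _ => s) = ![0, s] ∧
      faceIncl (n := 1) 2 (fun _ => s) = ![s, 0] := by
  refine ⟨?_, ?_, ?_⟩
  · ext i
    fin_cases i <;> simp [faceIncl]
  · ext i
    fin_cases i
    · rfl
    · rfl
  · ext i
    fin_cases i
    · rfl
    · rfl

/-- Green's theorem on the standard triangle, for Lipschitz functions. -/
theorem integral_Delta_jacobian {K L : NNReal} {α β : (Fin 2 → ℝ) → ℝ}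
    (hα : LipschitzOnWith K α (Delta 2)) (hβ : LipschitzOnWith L β (Delta 2)) :
    ∫ t in Delta 2, (fderiv ℝ α t (Pi.single 0 1) * fderiv ℝ β t (Pi.single 1 1) -
        fderiv ℝ α t (Pi.single 1 1) * fderiv ℝ β t (Pi.single 0 1)) =
      ∑ i : Fin 3, (-1) ^ (i : ℕ) * ∫ s in (0 : ℝ)..1, α (faceIncl i fun _ => s) *
        deriv (fun s => β (faceIncl i fun _ => s)) s := by
  obtain ⟨K', ha⟩ := lipschitzWith_comp_duffy hα
  obtain ⟨L', hb⟩ := lipschitzWith_comp_duffy hβ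
  have hcl : ∀ x, clamp (clamp x) = clamp x := fun x => clamp_of_mem (clamp_mem x)
  have hsq := integral_square_jacobian ha hb (fun x y => by simp only [hcl])
    (fun x y => by simp only [hcl])
  have hJ : ∫ p in Ioo (0 : ℝ) 1 ×ˢ Ioo (0 : ℝ) 1,
      jacobian (fun q => α (duffy (clamp q.1, clamp q.2)))
        (fun q => β (duffy (clamp q.1, clamp q.2))) p =
      ∫ t in Delta 2, (fderiv ℝ α t (Pi.single 0 1) * fderiv ℝ β t (Pi.single 1 1) -
        fderiv ℝ α t (Pi.single 1 1) * fderiv ℝ β t (Pi.single 0 1)) := by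
    rw [setIntegral_Delta_eq]
    refine setIntegral_congr_ae (measurableSet_Ioo.prod measurableSet_Ioo) ?_
    filter_upwards [ae_duffy (ae_differentiableAt_of_lipschitzOnWith_Delta hα),
      ae_duffy (ae_differentiableAt_of_lipschitzOnWith_Delta hβ)] with q h1 h2 hq
    obtain ⟨ha1, ha2⟩ := fderiv_comp_duffy hq.1 hq.2 (h1 hq)
    obtain ⟨hb1, hb2⟩ := fderiv_comp_duffy hq.1 hq.2 (h2 hq)
    rw [jacobian, ha1, ha2, hb1, hb2]
    ring
  have c0 : clamp 0 = 0 := clamp_of_le le_rfl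
  have c1 : clamp 1 = 1 := clamp_of_ge le_rfl
  have hcm : ∀ s ∈ Ioo (0 : ℝ) 1, clamp s = s := fun s hs => clamp_of_mem (Ioo_subset_Icc_self hs)
  rw [← hJ, hsq, Fin.sum_univ_three]
  -- The side `q.1 = 1` becomes face 0, `q.2 = 1` face 1 and `q.2 = 0` face 2; on `q.1 = 0` the map
  -- is constant and contributes nothing.
  simp only [(faceIncl_one_dim _).1, (faceIncl_one_dim _).2.1, (faceIncl_one_dim _).2.2, duffy, c0,
    c1, one_mul, zero_mul, mul_one, mul_zero, sub_zero, sub_self, deriv_const,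
    intervalIntegral.integral_zero]
  have hface : ∀ e : ℝ → Fin 2 → ℝ,
      ∫ s in (0 : ℝ)..1, α (e (clamp s)) * deriv (fun s => β (e (clamp s))) s =
        ∫ s in (0 : ℝ)..1, α (e s) * deriv (fun s => β (e s)) s := fun e =>
    intervalIntegral_mul_deriv_congr (fun s hs => by rw [hcm s hs]) (fun s hs => by rw [hcm s hs])
  rw [hface (fun s => ![1 - s, s]), hface (fun s => ![0, s]), hface (fun s => ![s, 0])]
  simp
  ring

/-! ## The cone over a surface -/

/-- The measure on the product of the standard triangle and the unit interval. -/
noncomputable abbrev prismMeasure : Measure ((Fin 2 → ℝ) × ℝ) :=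
  (volume.restrict (Delta 2)).prod (volume.restrict (Ioc (0 : ℝ) 1))

/-- The point `z + τ (σ(t) - z)` of the cone over `σ` with apex `z`. -/
noncomputable def Simplex.prismPoint (σ : Simplex 2) (z : Spacetime) (q : (Fin 2 → ℝ) × ℝ) :
    Spacetime :=
  z + q.2 • (σ.ext q.1 - z)

theorem Simplex.aestronglyMeasurable_ext {n : ℕ} (σ : Simplex n) :
    AEStronglyMeasurable σ.ext (volume.restrict (Delta n)) := by
  obtain ⟨K, hK⟩ := σ.exists_lipschitzOnWith
  exact hK.continuousOn.aestronglyMeasurable (isCompact_Delta n).measurableSet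

theorem Simplex.aestronglyMeasurable_prismPoint (σ : Simplex 2) (z : Spacetime) :
    AEStronglyMeasurable (σ.prismPoint z) prismMeasure :=
  aestronglyMeasurable_const.add
    (continuous_snd.aestronglyMeasurable.smul
      (σ.aestronglyMeasurable_ext.comp_fst.sub aestronglyMeasurable_const))

theorem ae_prismMeasure : ∀ᵐ q ∂prismMeasure, q.1 ∈ Delta 2 ∧ q.2 ∈ Ioc (0 : ℝ) 1 := by
  rw [prismMeasure, Measure.prod_restrict]
  exact ae_restrict_mem ((isCompact_Delta 2).measurableSet.prod measurableSet_Ioc)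

theorem Simplex.prismPoint_bound (σ : Simplex 2) (z : Spacetime) :
    ∃ R : ℝ, ∀ᵐ q ∂prismMeasure, ‖σ.prismPoint z q‖ ≤ R := by
  obtain ⟨R, hR⟩ := σ.exists_bound
  refine ⟨‖z‖ + 1 * (R + ‖z‖), ?_⟩
  filter_upwards [ae_prismMeasure] with q ⟨hq1, hq2⟩
  refine (norm_add_le _ _).trans ?_
  rw [norm_smul, Real.norm_of_nonneg hq2.1.le]
  gcongr
  · exact hq2.2
  · exact (norm_sub_le _ _).trans (add_le_add (hR _ hq1) le_rfl)

theorem Simplex.integrable_coord_mul (σ : Simplex 2) (z : Spacetime) (ρ : Fin 4)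
    {h : (Fin 2 → ℝ) → ℝ} (hh : Integrable h (volume.restrict (Delta 2))) :
    Integrable (fun t => (σ.ext t - z) ρ * h t) (volume.restrict (Delta 2)) := by
  obtain ⟨R, hR⟩ := σ.exists_bound
  refine hh.bdd_mul (c := R + ‖z‖) ?_ ?_
  · exact (EuclideanSpace.proj (𝕜 := ℝ) ρ).continuous.comp_aestronglyMeasurable
      (σ.aestronglyMeasurable_ext.sub aestronglyMeasurable_const)
  · filter_upwards [ae_restrict_mem (isCompact_Delta 2).measurableSet] with t ht
    exact (PiLp.norm_apply_le _ ρ).trans ((norm_sub_le _ _).trans (add_le_add (hR _ ht) le_rfl))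

theorem integrable_pow_mul {h : (Fin 2 → ℝ) → ℝ} (hh : Integrable h (volume.restrict (Delta 2)))
    (k : ℕ) : Integrable (fun q : (Fin 2 → ℝ) × ℝ => q.2 ^ k * h q.1) prismMeasure := by
  have h1 : Integrable (fun τ : ℝ => τ ^ k) (volume.restrict (Ioc (0 : ℝ) 1)) :=
    ((continuous_pow k).continuousOn.integrableOn_compact isCompact_Icc).mono_set
      Ioc_subset_Icc_self
  simpa only [mul_comm] using hh.mul_prod h1

theorem Simplex.integrable_prism (σ : Simplex 2) (z : Spacetime) (f : TestFn) (x : Spacetime)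
    {h : (Fin 2 → ℝ) → ℝ} (hh : Integrable h (volume.restrict (Delta 2))) (k : ℕ) :
    Integrable (fun q => q.2 ^ k * h q.1 * f (x - σ.prismPoint z q)) prismMeasure :=
  smear_integrable (σ.aestronglyMeasurable_prismPoint z) (integrable_pow_mul hh k) f x

/-- The component `(σ - z)^ρ σ^{μν} + (σ - z)^μ σ^{νρ} + (σ - z)^ν σ^{ρμ}` of the volume element of
the cone over `σ`. -/
noncomputable def Simplex.volumeElement (σ : Simplex 2) (z : Spacetime) (ρ μ ν : Fin 4)
    (t : Fin 2 → ℝ) : ℝ :=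
  (σ.ext t - z) ρ * σ.areaElement μ ν t + (σ.ext t - z) μ * σ.areaElement ν ρ t +
    (σ.ext t - z) ν * σ.areaElement ρ μ t

theorem Simplex.integrable_volumeElement (σ : Simplex 2) (z : Spacetime) (ρ μ ν : Fin 4) :
    Integrable (σ.volumeElement z ρ μ ν) (volume.restrict (Delta 2)) :=
  ((σ.integrable_coord_mul z ρ (σ.integrable_areaElement μ ν)).add
    (σ.integrable_coord_mul z μ (σ.integrable_areaElement ν ρ))).add
    (σ.integrable_coord_mul z ν (σ.integrable_areaElement ρ μ))

/-- The smearing of `f` over the cone with apex `z` over `σ`. -/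
noncomputable def volumeKernel (z : Spacetime) (σ : Simplex 2) (f : TestFn) (ρ μ ν : Fin 4) :
    TestFn :=
  mkSmear (m := prismMeasure) (p := σ.prismPoint z)
    (w := fun q => q.2 ^ 2 * σ.volumeElement z ρ μ ν q.1)
    (σ.aestronglyMeasurable_prismPoint z) (integrable_pow_mul (σ.integrable_volumeElement z ρ μ ν) 2)
    (σ.prismPoint_bound z) f _ (fun _ => rfl)

/-- This is the symmetry under which the first Maxwell equation can be applied to the divergence of
the kernel. -/
theorem volumeKernel_cyclic (z : Spacetime) (σ : Simplex 2) (f : TestFn) (ρ μ ν : Fin 4) :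
    volumeKernel z σ f ρ μ ν = volumeKernel z σ f μ ν ρ := by
  have h : σ.volumeElement z ρ μ ν = σ.volumeElement z μ ν ρ := by
    funext t
    simp only [Simplex.volumeElement]
    ring
  ext x
  change ∫ q, (q.2 ^ 2 * σ.volumeElement z ρ μ ν q.1) • f (x - σ.prismPoint z q) ∂prismMeasure =
    ∫ q, (q.2 ^ 2 * σ.volumeElement z μ ν ρ q.1) • f (x - σ.prismPoint z q) ∂prismMeasure
  rw [h]

theorem lineDeriv_volumeKernel_apply (z : Spacetime) (σ : Simplex 2) (f : TestFn) (ρ μ ν : Fin 4)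
    (v x : Spacetime) :
    (∂_{v} (volumeKernel z σ f ρ μ ν)) x =
      ∫ q, q.2 ^ 2 * σ.volumeElement z ρ μ ν q.1 * (∂_{v} f) (x - σ.prismPoint z q)
        ∂prismMeasure := by
  have hp := σ.aestronglyMeasurable_prismPoint z
  have hw := integrable_pow_mul (σ.integrable_volumeElement z ρ μ ν) 2
  have h := smear_hasFDerivAt hp hw f x
  rw [SchwartzMap.lineDerivOp_apply_eq_fderiv]
  change fderiv ℝ (fun x => ∫ q, (q.2 ^ 2 * σ.volumeElement z ρ μ ν q.1) •
    f (x - σ.prismPoint z q) ∂prismMeasure) x v = _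
  rw [h.fderiv, ContinuousLinearMap.integral_apply
    (smear_integrable hp hw (fderivCLM ℝ Spacetime ℝ f) x)]
  refine integral_congr_ae (Eventually.of_forall fun q => ?_)
  simp [SchwartzMap.lineDerivOp_apply_eq_fderiv]

theorem fderiv_testFn_apply (f : TestFn) (y v : Spacetime) :
    fderiv ℝ f y v = ∑ ρ, v ρ * (∂_{EuclideanSpace.single ρ (1 : ℝ)} f) y := by
  have hv : v = ∑ ρ, v ρ • EuclideanSpace.single ρ (1 : ℝ) := by
    ext i
    simp [Finset.sum_apply, Pi.single_apply]
  conv_lhs => rw [hv]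
  simp [map_sum, SchwartzMap.lineDerivOp_apply_eq_fderiv]

/-! ## Green's theorem for the pull-back of a one-form -/

theorem Simplex.exists_lipschitzOnWith_comp {n : ℕ} (σ : Simplex n) {A : Spacetime → ℝ}
    (hA : ContDiff ℝ 1 A) : ∃ K, LipschitzOnWith K (fun t => A (σ.ext t)) (Delta n) := by
  obtain ⟨K, hK⟩ := σ.exists_lipschitzOnWith
  obtain ⟨L, hL⟩ := (hA.locallyLipschitz.locallyLipschitzOn (s := σ.ext '' Delta n))
    |>.exists_lipschitzOnWith_of_compact ((isCompact_Delta n).image_of_continuousOn hK.continuousOn)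
  exact ⟨_, hL.comp hK (mapsTo_image _ _)⟩

theorem Simplex.path_face (σ : Simplex 2) (i : Fin 3) {s : ℝ} (hs : s ∈ Icc (0 : ℝ) 1) :
    (σ.face i).path s = σ.ext (faceIncl i fun _ => s) := by
  have hm : (fun _ : Fin 1 => s) ∈ Delta 1 := ⟨fun _ => hs.1, by simpa using hs.2⟩
  simp only [Simplex.path, Simplex.ext, extend, Simplex.face]
  rw [dif_pos hm, dif_pos (faceIncl_mem i hm)]

theorem Simplex.ae_differentiableAt_path (γ : Simplex 1) :
    ∀ᵐ s ∂(volume.restrict (Ioo (0 : ℝ) 1)), DifferentiableAt ℝ γ.path s := by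
  obtain ⟨K, hK⟩ := γ.path_lipschitzOnWith
  filter_upwards [(hK.mono Ioo_subset_Icc_self).ae_differentiableWithinAt_real measurableSet_Ioo,
    ae_restrict_mem measurableSet_Ioo] with s hs hs'
  exact hs.differentiableAt (isOpen_Ioo.mem_nhds hs')

theorem hasDerivAt_coord {γ : ℝ → Spacetime} {s : ℝ} (h : DifferentiableAt ℝ γ s) (ν : Fin 4) :
    HasDerivAt (fun s => γ s ν) (deriv γ s ν) s :=
  (EuclideanSpace.proj (𝕜 := ℝ) ν).hasFDerivAt.comp_hasDerivAt s h.hasDerivAt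

theorem Simplex.integral_face_mul_deriv (σ : Simplex 2) (A : Spacetime → ℝ) (ν : Fin 4)
    (i : Fin 3) :
    ∫ s in (0 : ℝ)..1, A (σ.ext (faceIncl i fun _ => s)) *
        deriv (fun s => σ.ext (faceIncl i fun _ => s) ν) s =
      ∫ s in Ioc (0 : ℝ) 1, A ((σ.face i).path s) * deriv (σ.face i).path s ν := by
  rw [intervalIntegral.integral_of_le zero_le_one, integral_Ioc_eq_integral_Ioo,
    integral_Ioc_eq_integral_Ioo]
  refine integral_congr_ae ?_
  filter_upwards [(σ.face i).ae_differentiableAt_path, ae_restrict_mem measurableSet_Ioo]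
    with s hs hs'
  have he : (fun s => σ.ext (faceIncl i fun _ => s) ν) =ᶠ[𝓝 s] fun s => (σ.face i).path s ν := by
    filter_upwards [isOpen_Ioo.mem_nhds hs'] with y hy
    rw [σ.path_face i (Ioo_subset_Icc_self hy)]
  rw [he.deriv_eq, (hasDerivAt_coord hs ν).deriv, σ.path_face i (Ioo_subset_Icc_self hs')]

/-- Stokes' theorem for the one-form `A dx^ν` and a Lipschitz singular simplex. -/
theorem Simplex.stokes (σ : Simplex 2) {A : Spacetime → ℝ} (hA : ContDiff ℝ 1 A) (ν : Fin 4) :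
    ∑ i : Fin 3, (-1) ^ (i : ℕ) *
        ∫ s in Ioc (0 : ℝ) 1, A ((σ.face i).path s) * deriv (σ.face i).path s ν =
      ∫ t in Delta 2, (fderiv ℝ A (σ.ext t) (σ.partialDeriv 0 t) * σ.partialDeriv 1 t ν -
        fderiv ℝ A (σ.ext t) (σ.partialDeriv 1 t) * σ.partialDeriv 0 t ν) := by
  obtain ⟨K, hK⟩ := σ.exists_lipschitzOnWith
  obtain ⟨M, hM⟩ := σ.exists_lipschitzOnWith_comp hA
  obtain ⟨L, hL⟩ := σ.exists_lipschitzOnWith_comp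
    (EuclideanSpace.proj (𝕜 := ℝ) ν : Spacetime →L[ℝ] ℝ).contDiff
  have h := integral_Delta_jacobian hM hL
  simp only [← σ.integral_face_mul_deriv A ν]
  refine Eq.trans h.symm ?_
  refine setIntegral_congr_ae (isCompact_Delta 2).measurableSet ?_
  -- Rademacher's theorem is used for `σ` itself; the chain rule then covers both `A ∘ σ` and the
  -- coordinate `σ^ν`.
  filter_upwards [ae_differentiableAt_of_lipschitzOnWith_Delta hK] with t ht ht'
  have hd := (ht ht').hasFDerivAt
  have h1 := ((hA.differentiable one_ne_zero (σ.ext t)).hasFDerivAt.comp t hd).fderiv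
  have h2 := ((EuclideanSpace.proj (𝕜 := ℝ) ν : Spacetime →L[ℝ] ℝ).hasFDerivAt.comp t hd).fderiv
  simp only [Function.comp_def] at h1 h2
  rw [h1, h2]
  rfl

/-! ## The homotopy formula for smeared simplices -/

/-- The coefficient `τ ^ 2` combines the prefactor `τ` with the ratio `τ` of the homothety about
`z`. -/
theorem hasFDerivAt_coneForm (f : TestFn) (x z : Spacetime) (τ : ℝ) (μ : Fin 4) (y : Spacetime) :
    HasFDerivAt (fun y => τ * f (x - (z + τ • (y - z))) * (y - z) μ)
      ((τ * f (x - (z + τ • (y - z)))) • EuclideanSpace.proj (𝕜 := ℝ) μ +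
        (y - z) μ • (-(τ ^ 2) • fderiv ℝ f (x - (z + τ • (y - z))))) y := by
  have h1 : HasFDerivAt (fun y => x - (z + τ • (y - z)))
      (-(τ • ContinuousLinearMap.id ℝ Spacetime)) y :=
    ((((hasFDerivAt_id y).sub_const z).const_smul τ).const_add z).const_sub x
  have h2 := ((f.differentiable (x - (z + τ • (y - z)))).hasFDerivAt.comp y h1).const_mul τ
  have h3 := (EuclideanSpace.proj (𝕜 := ℝ) μ : Spacetime →L[ℝ] ℝ).hasFDerivAt.comp y
    ((hasFDerivAt_id y).sub_const z)
  refine (h2.mul h3).congr_fderiv ?_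
  ext v
  simp [-mul_eq_mul_left_iff]
  ring

theorem contDiff_coneForm (f : TestFn) (x z : Spacetime) (τ : ℝ) (μ : Fin 4) :
    ContDiff ℝ 1 fun y : Spacetime => τ * f (x - (z + τ • (y - z))) * (y - z) μ := by
  have h1 : ContDiff ℝ 1 fun y : Spacetime => x - (z + τ • (y - z)) := by fun_prop
  have h2 : ContDiff ℝ 1 fun y : Spacetime => (y - z) μ :=
    (EuclideanSpace.proj (𝕜 := ℝ) μ : Spacetime →L[ℝ] ℝ).contDiff.comp
      (contDiff_id.sub contDiff_const)
  exact (contDiff_const.mul ((f.smooth 1).comp h1)).mul h2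

/-- The density on the prism which results from Stokes' theorem for the one-forms
`τ f(x - (z + τ (y - z))) (y - z)^μ dy^ν`. -/
noncomputable def Simplex.coneDensity (σ : Simplex 2) (z : Spacetime) (f : TestFn) (x : Spacetime)
    (μ ν : Fin 4) (q : (Fin 2 → ℝ) × ℝ) : ℝ :=
  q.2 ^ 1 * σ.areaElement μ ν q.1 * f (x - σ.prismPoint z q) -
    ∑ ρ, q.2 ^ 2 * ((σ.ext q.1 - z) μ * σ.areaElement ρ ν q.1) *
      (∂_{EuclideanSpace.single ρ (1 : ℝ)} f) (x - σ.prismPoint z q)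

theorem Simplex.integrable_coneDensity (σ : Simplex 2) (z : Spacetime) (f : TestFn) (x : Spacetime)
    (μ ν : Fin 4) : Integrable (σ.coneDensity z f x μ ν) prismMeasure :=
  (σ.integrable_prism z f x (σ.integrable_areaElement μ ν) 1).sub
    (integrable_finsetSum _ fun ρ _ => σ.integrable_prism z _ x
      (σ.integrable_coord_mul z μ (σ.integrable_areaElement ρ ν)) 2)

/-- Stokes' theorem on the slice of the cone at height `τ`: differentiating the factor `(y - z)^μ`
yields the area element `σ^{μν}`, differentiating `f` yields the terms in `σ^{ρν}`. -/
theorem Simplex.sum_face_eq_integral_coneDensity (σ : Simplex 2) (z : Spacetime) (f : TestFn)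
    (x : Spacetime) (μ ν : Fin 4) (τ : ℝ) :
    ∑ i : Fin 3, (-1) ^ (i : ℕ) * ∫ s in Ioc (0 : ℝ) 1,
        (σ.face i).coneWeight z μ ν (s, τ) • f (x - (σ.face i).conePoint z (s, τ)) =
      ∫ t in Delta 2, σ.coneDensity z f x μ ν (t, τ) := by
  have h := σ.stokes (contDiff_coneForm f x z τ μ) ν
  have h1 : ∀ i : Fin 3, ∫ s in Ioc (0 : ℝ) 1,
      (σ.face i).coneWeight z μ ν (s, τ) • f (x - (σ.face i).conePoint z (s, τ)) =
      ∫ s in Ioc (0 : ℝ) 1, τ * f (x - (z + τ • ((σ.face i).path s - z))) *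
        ((σ.face i).path s - z) μ * deriv (σ.face i).path s ν := fun i =>
    integral_congr_ae (Eventually.of_forall fun s => by
      simp only [Simplex.coneWeight, Simplex.conePoint, smul_eq_mul]
      ring)
  simp only [h1]
  rw [h]
  refine integral_congr_ae (Eventually.of_forall fun t => ?_)
  have hp : ∀ v : Spacetime, EuclideanSpace.proj (𝕜 := ℝ) μ v = v μ := fun _ => rfl
  simp only [(hasFDerivAt_coneForm f x z τ μ _).fderiv, add_apply, smul_apply, hp,
    fderiv_testFn_apply, Simplex.coneDensity, Simplex.prismPoint, Simplex.areaElement, smul_eq_mul, Fin.sum_univ_four]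
  ring

/-- Fubini puts the integral along the curve inside, so that Stokes' theorem can be applied at fixed
`τ`. -/
theorem lineKernel_apply (z : Spacetime) (γ : Simplex 1) (f : TestFn) (μ ν : Fin 4)
    (x : Spacetime) :
    lineKernel z γ f μ ν x = ∫ τ in Ioc (0 : ℝ) 1, ∫ s in Ioc (0 : ℝ) 1,
      γ.coneWeight z μ ν (s, τ) • f (x - γ.conePoint z (s, τ)) := by
  have h := smear_integrable (γ.aestronglyMeasurable_conePoint z)
    (γ.integrable_coneWeight z μ ν) f x
  rw [← integral_prod_symm _ h, integral_prod _ h]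
  change ∫ s in (0 : ℝ)..1, (∫ t in (0 : ℝ)..1,
    (γ.path s - z) μ * t * f (x - (z + t • (γ.path s - z)))) * deriv γ.path s ν = _
  rw [intervalIntegral.integral_of_le zero_le_one]
  refine integral_congr_ae (Eventually.of_forall fun s => ?_)
  simp only [intervalIntegral.integral_of_le zero_le_one, Simplex.coneWeight,
    Simplex.conePoint, smul_eq_mul]
  rw [← integral_mul_const]
  refine integral_congr_ae (Eventually.of_forall fun t => ?_)
  simp only
  ring

theorem sum_lineKernel_face (z : Spacetime) (σ : Simplex 2) (f : TestFn) (μ ν : Fin 4)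
    (x : Spacetime) :
    ∑ i : Fin 3, (-1) ^ (i : ℕ) * lineKernel z (σ.face i) f μ ν x =
      ∫ q, σ.coneDensity z f x μ ν q ∂prismMeasure := by
  rw [integral_prod_symm _ (σ.integrable_coneDensity z f x μ ν)]
  simp only [lineKernel_apply, ← σ.sum_face_eq_integral_coneDensity, ← integral_const_mul]
  rw [integral_finsetSum]
  intro i _
  simp only [integral_const_mul]
  exact ((smear_integrable ((σ.face i).aestronglyMeasurable_conePoint z)
    ((σ.face i).integrable_coneWeight z μ ν) f x).integral_prod_right).const_mul _

/-- The integrand is the `τ`-derivative of `τ² f(x - (z + τ (y - z))) c`. The factor `τ²` removes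
the contribution of the apex `τ = 0`, and `τ = 1` gives the value on the surface. -/
theorem integral_radial_derivative (f : TestFn) (x z y : Spacetime) (c : ℝ) :
    ∫ τ in Ioc (0 : ℝ) 1, (2 * (τ ^ 1 * c * f (x - (z + τ • (y - z)))) -
        ∑ ρ, τ ^ 2 * ((y - z) ρ * c) *
          (∂_{EuclideanSpace.single ρ (1 : ℝ)} f) (x - (z + τ • (y - z)))) =
      f (x - y) * c := by
  have hd : ∀ τ : ℝ, HasDerivAt (fun τ : ℝ => τ ^ 2 * f (x - (z + τ • (y - z))) * c)
      (2 * (τ ^ 1 * c * f (x - (z + τ • (y - z)))) -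
        ∑ ρ, τ ^ 2 * ((y - z) ρ * c) *
          (∂_{EuclideanSpace.single ρ (1 : ℝ)} f) (x - (z + τ • (y - z)))) τ := by
    intro τ
    have h1 : HasDerivAt (fun τ : ℝ => x - (z + τ • (y - z))) (-((1 : ℝ) • (y - z))) τ :=
      (((hasDerivAt_id τ).smul_const (y - z)).const_add z).const_sub x
    have h2 := (f.differentiable (x - (z + τ • (y - z)))).hasFDerivAt.comp_hasDerivAt τ h1
    refine (((hasDerivAt_pow 2 τ).mul h2).mul_const c).congr_deriv ?_
    rw [one_smul, map_neg, fderiv_testFn_apply]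
    simp only [Fin.sum_univ_four, Function.comp]
    push_cast
    ring
  rw [← intervalIntegral.integral_of_le zero_le_one,
    intervalIntegral.integral_eq_sub_of_hasDerivAt (fun τ _ => hd τ)]
  · simp
  · refine Continuous.intervalIntegrable ?_ _ _
    have hc : ∀ g : TestFn, Continuous fun τ : ℝ => g (x - (z + τ • (y - z))) := fun g =>
      g.continuous.comp (by fun_prop)
    have h1 := hc f
    have h2 := fun ρ : Fin 4 => hc (∂_{EuclideanSpace.single ρ (1 : ℝ)} f)
    fun_prop

theorem surfaceKernel_apply (z : Spacetime) (σ : Simplex 2) (f : TestFn) (μ ν : Fin 4)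
    (x : Spacetime) :
    surfaceKernel σ f μ ν x =
      ∫ q, (2 * (q.2 ^ 1 * σ.areaElement μ ν q.1 * f (x - σ.prismPoint z q)) -
        ∑ ρ, q.2 ^ 2 * ((σ.ext q.1 - z) ρ * σ.areaElement μ ν q.1) *
          (∂_{EuclideanSpace.single ρ (1 : ℝ)} f) (x - σ.prismPoint z q)) ∂prismMeasure := by
  rw [integral_prod]
  · exact integral_congr_ae (Eventually.of_forall fun t =>
      (integral_radial_derivative f x z (σ.ext t) (σ.areaElement μ ν t)).symm)
  · exact ((σ.integrable_prism z f x (σ.integrable_areaElement μ ν) 1).const_mul 2).sub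
      (integrable_finsetSum _ fun ρ _ => σ.integrable_prism z _ x
        (σ.integrable_coord_mul z ρ (σ.integrable_areaElement μ ν)) 2)

/-- The Poincaré homotopy formula, integrated over a singular simplex and smeared. -/
theorem sum_lineKernel_face_sub (z : Spacetime) (σ : Simplex 2) (f : TestFn) (μ ν : Fin 4) :
    ∑ i : Fin 3, (-1 : ℝ) ^ (i : ℕ) •
        (lineKernel z (σ.face i) f μ ν - lineKernel z (σ.face i) f ν μ) =
      surfaceKernel σ f μ ν +
        ∑ ρ, ∂_{EuclideanSpace.single ρ (1 : ℝ)} (volumeKernel z σ f ρ μ ν) := by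
  ext x
  have hL : (∑ i : Fin 3, (-1 : ℝ) ^ (i : ℕ) •
      (lineKernel z (σ.face i) f μ ν - lineKernel z (σ.face i) f ν μ)) x =
      ∑ i : Fin 3, (-1) ^ (i : ℕ) * lineKernel z (σ.face i) f μ ν x -
        ∑ i : Fin 3, (-1) ^ (i : ℕ) * lineKernel z (σ.face i) f ν μ x := by
    rw [← Finset.sum_sub_distrib]
    simp [mul_sub]
  have hR : (surfaceKernel σ f μ ν +
      ∑ ρ, ∂_{EuclideanSpace.single ρ (1 : ℝ)} (volumeKernel z σ f ρ μ ν)) x =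
      surfaceKernel σ f μ ν x +
        ∑ ρ, (∂_{EuclideanSpace.single ρ (1 : ℝ)} (volumeKernel z σ f ρ μ ν)) x := by
    simp
  have hv : ∀ ρ ∈ Finset.univ, Integrable (fun q => q.2 ^ 2 * σ.volumeElement z ρ μ ν q.1 *
      (∂_{EuclideanSpace.single ρ (1 : ℝ)} f) (x - σ.prismPoint z q)) prismMeasure := fun ρ _ =>
    σ.integrable_prism z _ x (σ.integrable_volumeElement z ρ μ ν) 2
  rw [hL, hR, sum_lineKernel_face, sum_lineKernel_face, surfaceKernel_apply z]
  simp only [lineDeriv_volumeKernel_apply]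
  rw [← integral_sub (σ.integrable_coneDensity z f x μ ν) (σ.integrable_coneDensity z f x ν μ),
    ← integral_finsetSum _ hv, ← integral_add _ (integrable_finsetSum _ hv)]
  -- Pointwise identity on the prism: antisymmetrising doubles the `f` term, and the radial terms
  -- `(σ - z)^ρ σ^{μν}` of the surface kernel cancel against those in the volume element.
  · refine integral_congr_ae (Eventually.of_forall fun q => ?_)
    simp only [Simplex.coneDensity, Simplex.volumeElement, Simplex.areaElement, Fin.sum_univ_four]
    ring
  · exact ((σ.integrable_prism z f x (σ.integrable_areaElement μ ν) 1).const_mul 2).sub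
      (integrable_finsetSum _ fun ρ _ => σ.integrable_prism z _ x
        (σ.integrable_coord_mul z ρ (σ.integrable_areaElement μ ν)) 2)

/-! ## The field -/

section Field

variable {ℋ : Type*} [NormedAddCommGroup ℋ] [InnerProductSpace ℂ ℋ] [CompleteSpace ℋ]

/-- Contraction with the antisymmetric field sees only the antisymmetric part of a tensor. -/
theorem QuantumEMField.sum_F_sub (Φ : QuantumEMField ℋ) (T : Fin 4 → Fin 4 → TestFn) :
    ∑ μ, ∑ ν, Φ.F μ ν (T μ ν - T ν μ) = (2 : ℂ) • ∑ μ, ∑ ν, Φ.F μ ν (T μ ν) := by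
  have h : ∑ μ, ∑ ν, Φ.F μ ν (T ν μ) = -∑ μ, ∑ ν, Φ.F μ ν (T μ ν) := by
    rw [Finset.sum_comm, ← Finset.sum_neg_distrib]
    refine Finset.sum_congr rfl fun μ _ => ?_
    rw [← Finset.sum_neg_distrib]
    exact Finset.sum_congr rfl fun ν _ => Φ.F_antisymm ν μ _
  simp only [map_sub, Finset.sum_sub_distrib]
  rw [h, sub_neg_eq_add, two_smul]

/-- The first Maxwell equation, tested with a cyclic tensor. -/
theorem QuantumEMField.sum_F_lineDeriv_eq_zero (Φ : QuantumEMField ℋ)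
    (T : Fin 4 → Fin 4 → Fin 4 → TestFn) (hT : ∀ ρ μ ν, T ρ μ ν = T μ ν ρ) :
    ∑ μ, ∑ ν, Φ.F μ ν (∑ ρ, ∂_{EuclideanSpace.single ρ (1 : ℝ)} (T ρ μ ν)) = 0 := by
  let G : Fin 4 → Fin 4 → Fin 4 → (Φ.D →ₗ[ℂ] Φ.D) := fun ρ μ ν =>
    Φ.F μ ν (∂_{EuclideanSpace.single ρ (1 : ℝ)} (T ρ μ ν))
  -- Cyclicity makes the three terms derivatives of one test function, as the Maxwell equation
  -- requires.
  have hG : ∀ ρ μ ν, G ρ μ ν + G μ ν ρ + G ν ρ μ = 0 := fun ρ μ ν => by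
    simp only [G, hT ν ρ μ, ← hT ρ μ ν]
    exact Φ.F_maxwell ρ μ ν (T ρ μ ν)
  have hc : ∀ H : Fin 4 → Fin 4 → Fin 4 → (Φ.D →ₗ[ℂ] Φ.D),
      ∑ a, ∑ b, ∑ c, H c a b = ∑ a, ∑ b, ∑ c, H a b c := fun H =>
    (Finset.sum_congr rfl fun a _ => Finset.sum_comm).trans Finset.sum_comm
  have h0 : ∑ μ, ∑ ν, Φ.F μ ν (∑ ρ, ∂_{EuclideanSpace.single ρ (1 : ℝ)} (T ρ μ ν)) =
      ∑ ρ, ∑ μ, ∑ ν, G ρ μ ν := by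
    simp only [map_sum]
    exact hc G
  -- Summed over all indices, the three cyclic terms are relabellings of the same triple sum.
  have h3 : (3 : ℂ) • ∑ ρ, ∑ μ, ∑ ν, G ρ μ ν = 0 := by
    have h := Finset.sum_eq_zero fun ρ (_ : ρ ∈ Finset.univ) =>
      Finset.sum_eq_zero fun μ (_ : μ ∈ Finset.univ) =>
        Finset.sum_eq_zero fun ν (_ : ν ∈ Finset.univ) => hG ρ μ ν
    simp only [Finset.sum_add_distrib] at h
    rw [← hc fun a b c => G b c a, hc G] at h
    rw [← h]
    module
  rw [h0]
  exact (smul_eq_zero.1 h3).resolve_left (by norm_num)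

theorem QuantumEMField.chainLineIntegral_boundary (Φ : QuantumEMField ℋ) (z : Spacetime)
    (σ : Simplex 2) (f : TestFn) :
    Φ.chainLineIntegral z σ.boundary f =
      Φ.lineIntegral z (σ.face 0) f - Φ.lineIntegral z (σ.face 1) f +
        Φ.lineIntegral z (σ.face 2) f := by
  rw [QuantumEMField.chainLineIntegral, Simplex.boundary,
    ← Finsupp.sum_finsetSum_index (fun _ => zero_zsmul _) (fun _ _ _ => add_zsmul _ _ _),
    Finset.sum_congr rfl fun i _ => Finsupp.sum_single_index (zero_zsmul _), Fin.sum_univ_three,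
    Fin.val_zero, Fin.val_one, Fin.val_two, pow_zero, pow_one, neg_one_sq, one_zsmul,
    neg_one_zsmul, one_zsmul, sub_eq_add_neg]

/-- Stokes' theorem for the operators, with the boundary as a chain. -/
theorem QuantumEMField.stokes (Φ : QuantumEMField ℋ) (z : Spacetime) (σ : Simplex 2)
    (f : TestFn) : Φ.chainLineIntegral z σ.boundary f = Φ.surfaceIntegral σ f := by
  let T : Fin 4 → Fin 4 → TestFn := fun μ ν =>
    ∑ i : Fin 3, (-1 : ℝ) ^ (i : ℕ) • lineKernel z (σ.face i) f μ ν
  have h1 : Φ.chainLineIntegral z σ.boundary f = ∑ μ, ∑ ν, Φ.F μ ν (T μ ν) := by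
    have hT : ∀ μ ν, T μ ν = lineKernel z (σ.face 0) f μ ν - lineKernel z (σ.face 1) f μ ν +
        lineKernel z (σ.face 2) f μ ν := fun μ ν => by
      simp [T, Fin.sum_univ_three, sub_eq_add_neg]
    rw [Φ.chainLineIntegral_boundary]
    simp only [hT, map_add, map_sub, Finset.sum_add_distrib, Finset.sum_sub_distrib]
    rfl
  have h2 : ∀ μ ν, T μ ν - T ν μ = surfaceKernel σ f μ ν +
      ∑ ρ, ∂_{EuclideanSpace.single ρ (1 : ℝ)} (volumeKernel z σ f ρ μ ν) := fun μ ν => by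
    rw [← sum_lineKernel_face_sub, ← Finset.sum_sub_distrib]
    simp only [smul_sub]
  -- Applying the field to the homotopy formula gives twice the line integral on one side and, once
  -- the divergence is dropped, the surface kernel on the other.
  have h3 := Φ.sum_F_sub T
  simp only [h2, map_add, Finset.sum_add_distrib] at h3
  rw [Φ.sum_F_lineDeriv_eq_zero _ (volumeKernel_cyclic z σ f), add_zero] at h3
  rw [h1, QuantumEMField.surfaceIntegral, h3, smul_smul]
  norm_num

end Field

end QED

theorem proposition3p10 {ℋ : Type*} [NormedAddCommGroup ℋ] [InnerProductSpace ℂ ℋ]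
    [CompleteSpace ℋ] (Φ : QED.QuantumEMField ℋ) (z : QED.Spacetime) (f : QED.TestFn)
    (hf : (0 : QED.Spacetime) ∈ tsupport f) (σ : QED.Simplex 2) :
    (∀ γ : QED.Simplex 1, Finsupp.single γ 1 = σ.boundary →
      Φ.lineIntegral z γ f = Φ.surfaceIntegral σ f) ∧
    (∀ ℓ : QED.Chain 1, ℓ = σ.boundary →
      Φ.chainLineIntegral z ℓ f = Φ.surfaceIntegral σ f) := by
  -- The curve enters as the chain `Finsupp.single γ 1`, so both claims are the chain form of
  -- Stokes' theorem.
  refine ⟨fun γ hγ => ?_, fun ℓ hℓ => hℓ ▸ Φ.stokes z σ f⟩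
  rw [← Φ.stokes z σ f, ← hγ, QED.QuantumEMField.chainLineIntegral,
    Finsupp.sum_single_index (zero_zsmul _), one_zsmul]
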